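/- Let $\mathcal A$ be a unital $C^*$-algebra and let $\pi:\mathcal A\to\mathbf L(\mathcal H)$ be a faithful atomic representation, i.e. a faithful representation that is (unitarily equivalent to) a Hilbert direct sum of pairwise inequivalent irreducible representations. Write $\mathcal A\check\otimes\mathcal A$ for the spatial $C^*$-tensor product, regarded via $\pi\otimes\pi$ as an algebra of operators on the Hilbert space tensor product $\mathcal H\bar\otimes\mathcal H$. Let $P_\delta$ be the supremum of all projections $p\otimes p$ on $\mathcal H\bar\otimes\mathcal H$ with $p$ a minimal projection of the von Neumann algebra $\pi(\mathcal A)''$, and let $\mathcal H_\delta$ be its image. The triple $(\mathcal A,\rho,\pi)$ is called a compact quantum metric space if $\rho\in\mathcal A\check\otimes\mathcal A$ satisfies: (i) $\rho\ge 0$; (ii) $\rho P_\delta=P_\delta\rho=0$; (iii) $0$ is not an eigenvalue of the restriction of $\rho$ to $\mathcal H_\delta^\perp$; (iv) $\mathfrak F(\rho)=\rho$, where $\mathfrak F(a\otimes b)=b\otimes a$ is the flip; (v) $\mathfrak M(\rho)\le\rho\otimes 1+1\otimes\rho$ in $\mathcal A\check\otimes\mathcal A\check\otimes\mathcal A$,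 where $\mathfrak M$ is the $*$-morphism with $\mathfrak M(a\otimes b)=a\otimes 1\otimes b$. **Theorem 4.** Let $(\mathcal A_1,\rho_1,\pi_1)$ and $(\mathcal A_2,\rho_2,\pi_2)$ be compact quantum metric spaces. Then $(\mathcal A_1\check\otimes\mathcal A_2,\rho,\pi_1\otimes\pi_2)$ is a compact quantum metric space, where $$\rho=\rho_1\otimes 1_{\mathcal A_2\check\otimes\mathcal A_2}+1_{\mathcal A_1\check\otimes\mathcal A_1}\otimes\rho_2\in(\mathcal A_1\check\otimes\mathcal A_1)\check\otimes(\mathcal A_2\check\otimes\mathcal A_2)\cong(\mathcal A_1\check\otimes\mathcal A_2)\check\otimes(\mathcal A_1\check\otimes\mathcal A_2),$$ the isomorphism being $(a\otimes a')\otimes(b\otimes b')\mapsto(a\otimes b)\otimes(a'\otimes b')$. -/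

import Mathlib

open scoped TensorProduct
open UniformSpace (Completion)

noncomputable section

namespace QuantumMetric

/-! ### Hilbert space tensor products and tensor products of operators -/

section HilbertTensor

/-- The Hilbert space tensor product: the completion of the algebraic tensor product with respect
to the inner product `⟪x ⊗ y, x' ⊗ y'⟫ = ⟪x, x'⟫ * ⟪y, y'⟫`. -/
def HilbertTensor (H K : Type*) [NormedAddCommGroup H] [InnerProductSpace ℂ H]
    [NormedAddCommGroup K] [InnerProductSpace ℂ K] : Type _ :=
  Completion (H ⊗[ℂ] K)

variable {H K L M : Type*}
  [NormedAddCommGroup H] [InnerProductSpace ℂ H]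
  [NormedAddCommGroup K] [InnerProductSpace ℂ K]
  [NormedAddCommGroup L] [InnerProductSpace ℂ L]
  [NormedAddCommGroup M] [InnerProductSpace ℂ M]

instance : NormedAddCommGroup (HilbertTensor H K) :=
  inferInstanceAs (NormedAddCommGroup (Completion (H ⊗[ℂ] K)))

instance : InnerProductSpace ℂ (HilbertTensor H K) :=
  inferInstanceAs (InnerProductSpace ℂ (Completion (H ⊗[ℂ] K)))

instance : CompleteSpace (HilbertTensor H K) :=
  inferInstanceAs (CompleteSpace (Completion (H ⊗[ℂ] K)))

/-- The canonical isometric embedding of the algebraic tensor product. -/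
def emb (H K : Type*) [NormedAddCommGroup H] [InnerProductSpace ℂ H]
    [NormedAddCommGroup K] [InnerProductSpace ℂ K] : H ⊗[ℂ] K →ₗᵢ[ℂ] HilbertTensor H K :=
  (Completion.toComplₗᵢ : H ⊗[ℂ] K →ₗᵢ[ℂ] Completion (H ⊗[ℂ] K))

theorem denseRange_emb : DenseRange (emb H K) :=
  Completion.denseRange_coe (α := H ⊗[ℂ] K)

/-- The elementary tensor `x ⊗ y` in the Hilbert space tensor product. -/
def htmul (x : H) (y : K) : HilbertTensor H K := emb H K (x ⊗ₜ[ℂ] y)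

theorem inner_htmul (x x' : H) (y y' : K) :
    inner ℂ (htmul x y) (htmul x' y') = inner ℂ x x' * inner ℂ y y' := by
  rw [htmul, htmul, LinearIsometry.inner_map_map, TensorProduct.inner_tmul]

/-- The tensor product `S ⊗ T` of bounded operators: the bounded operator on the Hilbert space
tensor product with `(S ⊗ T) (x ⊗ y) = S x ⊗ T y`. -/
def opTensor (S : H →L[ℂ] L) (T : K →L[ℂ] M) : HilbertTensor H K →L[ℂ] HilbertTensor L M :=
  ((emb L M).toContinuousLinearMap.comp (TensorProduct.mapL S T)).extend
    (emb H K).toContinuousLinearMap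

theorem opTensor_emb (S : H →L[ℂ] L) (T : K →L[ℂ] M) (z : H ⊗[ℂ] K) :
    opTensor S T (emb H K z) = emb L M (TensorProduct.mapL S T z) :=
  ContinuousLinearMap.extend_eq _ (e := (emb H K).toContinuousLinearMap)
    denseRange_emb (emb H K).isometry.isUniformInducing z

theorem opTensor_htmul (S : H →L[ℂ] L) (T : K →L[ℂ] M) (x : H) (y : K) :
    opTensor S T (htmul x y) = htmul (S x) (T y) := by
  rw [htmul, opTensor_emb]; rfl

/-- The span of the elementary tensors is dense. -/
theorem denseRange_tensor_map {X X' Y Y' : Type*}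
    [NormedAddCommGroup X] [InnerProductSpace ℂ X] [NormedAddCommGroup X'] [InnerProductSpace ℂ X']
    [NormedAddCommGroup Y] [InnerProductSpace ℂ Y] [NormedAddCommGroup Y'] [InnerProductSpace ℂ Y']
    (e : X →ₗᵢ[ℂ] X') (f : Y →ₗᵢ[ℂ] Y') (he : DenseRange e) (hf : DenseRange f) :
    DenseRange ((emb X' Y').comp (TensorProduct.mapIsometry e f)) := by
  have key : DenseRange (TensorProduct.mapIsometry e f) := by
    have hcl : ∀ z : X' ⊗[ℂ] Y',
        z ∈ (LinearMap.range (TensorProduct.mapIsometry e f).toLinearMap).topologicalClosure := by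
      intro z
      induction z with
      | zero => exact Submodule.zero_mem _
      | add a b ha hb => exact Submodule.add_mem _ ha hb
      | tmul x y =>
        have hd : DenseRange (Prod.map e f) := he.prodMap hf
        have hc : Continuous fun p : X' × Y' => (p.1 ⊗ₜ[ℂ] p.2 : X' ⊗[ℂ] Y') :=
          TensorProduct.continuous_tmul
        refine hd.induction_on (p := fun p : X' × Y' => p.1 ⊗ₜ[ℂ] p.2 ∈
          (LinearMap.range (TensorProduct.mapIsometry e f).toLinearMap).topologicalClosure)
          (x, y) ?_ ?_
        · exact (Submodule.isClosed_topologicalClosure _).preimage hc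
        · rintro ⟨a, b⟩
          exact Submodule.le_topologicalClosure _ ⟨a ⊗ₜ[ℂ] b, by simp⟩
    intro z
    exact hcl z
  exact denseRange_emb.comp key (emb X' Y').continuous

/-- The canonical isometric embedding of `(H ⊗ K) ⊗ L` (algebraic) into the Hilbert space tensor
product of `H ⊗ K` and `L`. -/
def embLeft (H K L : Type*) [NormedAddCommGroup H] [InnerProductSpace ℂ H]
    [NormedAddCommGroup K] [InnerProductSpace ℂ K] [NormedAddCommGroup L] [InnerProductSpace ℂ L] :
    (H ⊗[ℂ] K) ⊗[ℂ] L →ₗᵢ[ℂ] HilbertTensor (HilbertTensor H K) L :=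
  (emb (HilbertTensor H K) L).comp (TensorProduct.mapIsometry (emb H K) LinearIsometry.id)

/-- The canonical isometric embedding of `H ⊗ (K ⊗ L)` (algebraic) into the Hilbert space tensor
product of `H` and `K ⊗ L`. -/
def embRight (H K L : Type*) [NormedAddCommGroup H] [InnerProductSpace ℂ H]
    [NormedAddCommGroup K] [InnerProductSpace ℂ K] [NormedAddCommGroup L] [InnerProductSpace ℂ L] :
    H ⊗[ℂ] (K ⊗[ℂ] L) →ₗᵢ[ℂ] HilbertTensor H (HilbertTensor K L) :=
  (emb H (HilbertTensor K L)).comp (TensorProduct.mapIsometry LinearIsometry.id (emb K L))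

/-- The canonical isometric embedding of `(H ⊗ K) ⊗ (L ⊗ M)` (algebraic) into the Hilbert space
tensor product of `H ⊗ K` and `L ⊗ M`. -/
def embBoth (H K L M : Type*) [NormedAddCommGroup H] [InnerProductSpace ℂ H]
    [NormedAddCommGroup K] [InnerProductSpace ℂ K] [NormedAddCommGroup L] [InnerProductSpace ℂ L]
    [NormedAddCommGroup M] [InnerProductSpace ℂ M] :
    (H ⊗[ℂ] K) ⊗[ℂ] (L ⊗[ℂ] M) →ₗᵢ[ℂ] HilbertTensor (HilbertTensor H K) (HilbertTensor L M) :=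
  (emb (HilbertTensor H K) (HilbertTensor L M)).comp
    (TensorProduct.mapIsometry (emb H K) (emb L M))

theorem denseRange_embLeft : DenseRange (embLeft H K L) :=
  denseRange_tensor_map _ _ denseRange_emb Function.surjective_id.denseRange

theorem denseRange_embRight : DenseRange (embRight H K L) :=
  denseRange_tensor_map _ _ Function.surjective_id.denseRange denseRange_emb

theorem denseRange_embBoth : DenseRange (embBoth H K L M) :=
  denseRange_tensor_map _ _ denseRange_emb denseRange_emb

/-- The unitary `H ⊗ K ≅ K ⊗ H`, `x ⊗ y ↦ y ⊗ x`. -/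
def hcomm (H K : Type*) [NormedAddCommGroup H] [InnerProductSpace ℂ H]
    [NormedAddCommGroup K] [InnerProductSpace ℂ K] :
    HilbertTensor H K ≃ₗᵢ[ℂ] HilbertTensor K H :=
  (TensorProduct.comm ℂ H K).extendOfIsometry
    (emb H K).toLinearMap
    (emb K H).toLinearMap
    denseRange_emb denseRange_emb
    (fun x => ((emb K H).norm_map _).trans
      ((TensorProduct.norm_comm x).trans ((emb H K).norm_map x).symm))

/-- The unitary `(H ⊗ K) ⊗ L ≅ H ⊗ (K ⊗ L)`, `(x ⊗ y) ⊗ z ↦ x ⊗ (y ⊗ z)`. -/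
def hassoc (H K L : Type*) [NormedAddCommGroup H] [InnerProductSpace ℂ H]
    [NormedAddCommGroup K] [InnerProductSpace ℂ K] [NormedAddCommGroup L] [InnerProductSpace ℂ L] :
    HilbertTensor (HilbertTensor H K) L ≃ₗᵢ[ℂ] HilbertTensor H (HilbertTensor K L) :=
  (TensorProduct.assoc ℂ H K L).extendOfIsometry
    (embLeft H K L).toLinearMap (embRight H K L).toLinearMap
    denseRange_embLeft denseRange_embRight
    (fun x => ((embRight H K L).norm_map _).trans
      ((TensorProduct.norm_assoc x).trans ((embLeft H K L).norm_map x).symm))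

/-- The isometry `(H ⊗ K) ⊗ L ≅ (H ⊗ L) ⊗ K`, `(x ⊗ y) ⊗ z ↦ (x ⊗ z) ⊗ y`, on algebraic tensor
products. -/
def rightCommIsometry (H K L : Type*) [NormedAddCommGroup H] [InnerProductSpace ℂ H]
    [NormedAddCommGroup K] [InnerProductSpace ℂ K] [NormedAddCommGroup L] [InnerProductSpace ℂ L] :
    (H ⊗[ℂ] K) ⊗[ℂ] L ≃ₗᵢ[ℂ] (H ⊗[ℂ] L) ⊗[ℂ] K :=
  ((TensorProduct.assocIsometry ℂ H K L).trans
    ((TensorProduct.commIsometry ℂ K L).lTensor H)).trans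
      (TensorProduct.assocIsometry ℂ H L K).symm

/-- The isometry `(H ⊗ K) ⊗ (L ⊗ M) ≅ (H ⊗ L) ⊗ (K ⊗ M)`,
`(x ⊗ y) ⊗ (z ⊗ w) ↦ (x ⊗ z) ⊗ (y ⊗ w)`, on algebraic tensor products. -/
def interchangeIsometry (H K L M : Type*) [NormedAddCommGroup H] [InnerProductSpace ℂ H]
    [NormedAddCommGroup K] [InnerProductSpace ℂ K] [NormedAddCommGroup L] [InnerProductSpace ℂ L]
    [NormedAddCommGroup M] [InnerProductSpace ℂ M] :
    (H ⊗[ℂ] K) ⊗[ℂ] (L ⊗[ℂ] M) ≃ₗᵢ[ℂ] (H ⊗[ℂ] L) ⊗[ℂ] (K ⊗[ℂ] M) :=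
  ((TensorProduct.assocIsometry ℂ (H ⊗[ℂ] K) L M).symm.trans
    ((rightCommIsometry H K L).rTensor M)).trans
      (TensorProduct.assocIsometry ℂ (H ⊗[ℂ] L) K M)

/-- The unitary `(H ⊗ K) ⊗ L ≅ (H ⊗ L) ⊗ K`, `(x ⊗ y) ⊗ z ↦ (x ⊗ z) ⊗ y`. -/
def hrightComm (H K L : Type*) [NormedAddCommGroup H] [InnerProductSpace ℂ H]
    [NormedAddCommGroup K] [InnerProductSpace ℂ K] [NormedAddCommGroup L] [InnerProductSpace ℂ L] :
    HilbertTensor (HilbertTensor H K) L ≃ₗᵢ[ℂ] HilbertTensor (HilbertTensor H L) K :=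
  (rightCommIsometry H K L).toLinearEquiv.extendOfIsometry
    (embLeft H K L).toLinearMap (embLeft H L K).toLinearMap
    denseRange_embLeft denseRange_embLeft
    (fun x => ((embLeft H L K).norm_map _).trans
      (((rightCommIsometry H K L).norm_map x).trans ((embLeft H K L).norm_map x).symm))

/-- The unitary `(H ⊗ K) ⊗ (L ⊗ M) ≅ (H ⊗ L) ⊗ (K ⊗ M)`,
`(x ⊗ y) ⊗ (z ⊗ w) ↦ (x ⊗ z) ⊗ (y ⊗ w)`. -/
def hinterchange (H K L M : Type*) [NormedAddCommGroup H] [InnerProductSpace ℂ H]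
    [NormedAddCommGroup K] [InnerProductSpace ℂ K] [NormedAddCommGroup L] [InnerProductSpace ℂ L]
    [NormedAddCommGroup M] [InnerProductSpace ℂ M] :
    HilbertTensor (HilbertTensor H K) (HilbertTensor L M) ≃ₗᵢ[ℂ]
      HilbertTensor (HilbertTensor H L) (HilbertTensor K M) :=
  (interchangeIsometry H K L M).toLinearEquiv.extendOfIsometry
    (embBoth H K L M).toLinearMap (embBoth H L K M).toLinearMap
    denseRange_embBoth denseRange_embBoth
    (fun x => ((embBoth H L K M).norm_map _).trans
      (((interchangeIsometry H K L M).norm_map x).trans ((embBoth H K L M).norm_map x).symm))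

theorem hcomm_htmul (x : H) (y : K) : hcomm H K (htmul x y) = htmul y x :=
  LinearEquiv.extendOfIsometry_eq (TensorProduct.comm ℂ H K) _ _
    denseRange_emb denseRange_emb _ (x ⊗ₜ[ℂ] y)

theorem hassoc_htmul (x : H) (y : K) (z : L) :
    hassoc H K L (htmul (htmul x y) z) = htmul x (htmul y z) :=
  LinearEquiv.extendOfIsometry_eq (TensorProduct.assoc ℂ H K L) _ _
    denseRange_embLeft denseRange_embRight _ ((x ⊗ₜ[ℂ] y) ⊗ₜ[ℂ] z)

theorem hrightComm_htmul (x : H) (y : K) (z : L) :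
    hrightComm H K L (htmul (htmul x y) z) = htmul (htmul x z) y :=
  LinearEquiv.extendOfIsometry_eq (rightCommIsometry H K L).toLinearEquiv _ _
    denseRange_embLeft denseRange_embLeft _ ((x ⊗ₜ[ℂ] y) ⊗ₜ[ℂ] z)

theorem hinterchange_htmul (x : H) (y : K) (z : L) (w : M) :
    hinterchange H K L M (htmul (htmul x y) (htmul z w)) = htmul (htmul x z) (htmul y w) :=
  LinearEquiv.extendOfIsometry_eq (interchangeIsometry H K L M).toLinearEquiv _ _
    denseRange_embBoth denseRange_embBoth _ ((x ⊗ₜ[ℂ] y) ⊗ₜ[ℂ] (z ⊗ₜ[ℂ] w))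

end HilbertTensor

/-! ### Representations -/

section Representations

variable {A : Type*} [CStarAlgebra A]

/-- A (unital) representation on a Hilbert space `H` is irreducible if `H ≠ 0` and the only closed
invariant subspaces are `0` and `H`. -/
def IsIrreducibleRep {H : Type*} [NormedAddCommGroup H] [InnerProductSpace ℂ H] [CompleteSpace H]
    (π : A →⋆ₐ[ℂ] (H →L[ℂ] H)) : Prop :=
  Nontrivial H ∧ ∀ V : Submodule ℂ H, IsClosed (V : Set H) →
    (∀ a : A, ∀ x ∈ V, π a x ∈ V) → V = ⊥ ∨ V = ⊤

/-- Unitary equivalence of representations. -/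
def EquivalentReps {H K : Type*}
    [NormedAddCommGroup H] [InnerProductSpace ℂ H] [CompleteSpace H]
    [NormedAddCommGroup K] [InnerProductSpace ℂ K] [CompleteSpace K]
    (π : A →⋆ₐ[ℂ] (H →L[ℂ] H)) (σ : A →⋆ₐ[ℂ] (K →L[ℂ] K)) : Prop :=
  ∃ U : H ≃ₗᵢ[ℂ] K, ∀ (a : A) (x : H), U (π a x) = σ a (U x)

/-- A representation is atomic if it is (unitarily equivalent to) the Hilbert direct sum of a family
of pairwise inequivalent irreducible representations. The summands embed in `H`, so it is no
restriction to take them, and their index set, in the universe of `H`. -/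
def IsAtomicRep.{u, v} {A : Type v} [CStarAlgebra A] {H : Type u} [NormedAddCommGroup H] [InnerProductSpace ℂ H] [CompleteSpace H]
    (π : A →⋆ₐ[ℂ] (H →L[ℂ] H)) : Prop :=
  ∃ (ι : Type u) (E : ι → Type u)
    (_ : ∀ i, NormedAddCommGroup (E i)) (_ : ∀ i, InnerProductSpace ℂ (E i))
    (_ : ∀ i, CompleteSpace (E i)) (σ : ∀ i, A →⋆ₐ[ℂ] (E i →L[ℂ] E i)),
    (∀ i, IsIrreducibleRep (σ i)) ∧
    (∀ i j, i ≠ j → ¬ EquivalentReps (σ i) (σ j)) ∧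
    ∃ U : H ≃ₗᵢ[ℂ] lp E 2, ∀ (a : A) (x : H) (i : ι), U (π a x) i = σ i a (U x i)

end Representations

/-! ### Spatial tensor product -/

section Spatial

variable {A B : Type*} [CStarAlgebra A] [CStarAlgebra B]
  {H K : Type*} [NormedAddCommGroup H] [InnerProductSpace ℂ H] [CompleteSpace H]
  [NormedAddCommGroup K] [InnerProductSpace ℂ K] [CompleteSpace K]

/-- The spatial tensor product of two C⋆-algebras, realised through (faithful) representations `π`
and `σ`: the C⋆-algebra of operators on the Hilbert space tensor product that is generated by the
operators `π a ⊗ σ b`. -/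
def spatialTensor (π : A →⋆ₐ[ℂ] (H →L[ℂ] H)) (σ : B →⋆ₐ[ℂ] (K →L[ℂ] K)) :
    StarSubalgebra ℂ (HilbertTensor H K →L[ℂ] HilbertTensor H K) :=
  (StarAlgebra.adjoin ℂ {T | ∃ (a : A) (b : B), T = opTensor (π a) (σ b)}).topologicalClosure

instance spatialTensor_isClosed (π : A →⋆ₐ[ℂ] (H →L[ℂ] H)) (σ : B →⋆ₐ[ℂ] (K →L[ℂ] K)) :
    IsClosed (spatialTensor π σ : Set (HilbertTensor H K →L[ℂ] HilbertTensor H K)) :=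
  StarSubalgebra.isClosed_topologicalClosure _

/-- The tensor product representation `π ⊗ σ` of the spatial tensor product. As the latter is
realised as an algebra of operators on the Hilbert space tensor product, this is the inclusion. -/
def tensorRep (π : A →⋆ₐ[ℂ] (H →L[ℂ] H)) (σ : B →⋆ₐ[ℂ] (K →L[ℂ] K)) :
    spatialTensor π σ →⋆ₐ[ℂ] (HilbertTensor H K →L[ℂ] HilbertTensor H K) :=
  (spatialTensor π σ).subtype

end Spatial

/-! ### Quantum metrics -/

section QuantumMetrics

variable {A : Type*} [CStarAlgebra A]
  {H : Type*} [NormedAddCommGroup H] [InnerProductSpace ℂ H] [CompleteSpace H]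

/-- The enveloping von Neumann algebra `π(A)''`, the bicommutant of the range of `π`. -/
def envelopingAlgebra (π : A →⋆ₐ[ℂ] (H →L[ℂ] H)) : Set (H →L[ℂ] H) :=
  Set.centralizer (Set.centralizer (Set.range π))

/-- `p` is a minimal projection of the algebra `N` of operators. -/
def IsMinimalProjection (N : Set (H →L[ℂ] H)) (p : H →L[ℂ] H) : Prop :=
  p ∈ N ∧ IsStarProjection p ∧ p ≠ 0 ∧
    ∀ q ∈ N, IsStarProjection q → q ≤ p → q = 0 ∨ q = p

/-- The subspace `H_δ`: the closed linear span of the ranges of the projections `p ⊗ p`, for `p` a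
minimal projection of `π(A)''`. -/
def diagonalSubspace (π : A →⋆ₐ[ℂ] (H →L[ℂ] H)) : Submodule ℂ (HilbertTensor H H) :=
  (⨆ p : {p : H →L[ℂ] H // IsMinimalProjection (envelopingAlgebra π) p},
    LinearMap.range (opTensor p.1 p.1).toLinearMap).topologicalClosure

instance (π : A →⋆ₐ[ℂ] (H →L[ℂ] H)) : CompleteSpace (diagonalSubspace π) :=
  Submodule.topologicalClosure.completeSpace _

/-- The characteristic function of the diagonal, `P_δ`: the supremum of the projections `p ⊗ p`, for
`p` a minimal projection of `π(A)''`, that is, the orthogonal projection onto the closed linear span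
of their ranges. -/
def diagonalProjection (π : A →⋆ₐ[ℂ] (H →L[ℂ] H)) : HilbertTensor H H →L[ℂ] HilbertTensor H H :=
  (diagonalSubspace π).starProjection

/-- The flip `a ⊗ b ↦ b ⊗ a`. -/
def flip (T : HilbertTensor H H →L[ℂ] HilbertTensor H H) :
    HilbertTensor H H →L[ℂ] HilbertTensor H H :=
  (hcomm H H).conjStarAlgEquiv T

/-- `T ↦ T ⊗ 1`, on the Hilbert space tensor product `(H ⊗ H) ⊗ H`. -/
def tensorOne (T : HilbertTensor H H →L[ℂ] HilbertTensor H H) :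
    HilbertTensor (HilbertTensor H H) H →L[ℂ] HilbertTensor (HilbertTensor H H) H :=
  opTensor T (ContinuousLinearMap.id ℂ H)

/-- `T ↦ 1 ⊗ T`, on the Hilbert space tensor product `(H ⊗ H) ⊗ H ≅ H ⊗ (H ⊗ H)`. -/
def oneTensor (T : HilbertTensor H H →L[ℂ] HilbertTensor H H) :
    HilbertTensor (HilbertTensor H H) H →L[ℂ] HilbertTensor (HilbertTensor H H) H :=
  (hassoc H H H).symm.conjStarAlgEquiv (opTensor (ContinuousLinearMap.id ℂ H) T)

/-- The morphism `a ⊗ b ↦ a ⊗ 1 ⊗ b`. -/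
def midOne (T : HilbertTensor H H →L[ℂ] HilbertTensor H H) :
    HilbertTensor (HilbertTensor H H) H →L[ℂ] HilbertTensor (HilbertTensor H H) H :=
  (hrightComm H H H).conjStarAlgEquiv (tensorOne T)

/-- `(A, ρ, π)` is a compact quantum metric space. Here `A` is a unital C⋆-algebra, `π` is a
representation of `A` on `H`, and `A ⊗ A` is regarded as an algebra of operators on `H ⊗ H`. -/
structure IsCompactQuantumMetricSpace (π : A →⋆ₐ[ℂ] (H →L[ℂ] H))
    (ρ : HilbertTensor H H →L[ℂ] HilbertTensor H H) : Prop where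
  faithful : Function.Injective π
  atomic : IsAtomicRep π
  mem : ρ ∈ spatialTensor π π
  nonneg : 0 ≤ ρ
  mul_diagonal : ρ * diagonalProjection π = 0
  diagonal_mul : diagonalProjection π * ρ = 0
  /-- `0` is not an eigenvalue of `ρ` on the orthogonal complement of `H_δ`. -/
  eq_zero_of_apply_eq_zero : ∀ x ∈ (diagonalSubspace π)ᗮ, ρ x = 0 → x = 0
  flip_eq : flip ρ = ρ
  triangle : midOne ρ ≤ tensorOne ρ + oneTensor ρ

end QuantumMetrics

/-- The element `ρ₁ ⊗ 1 + 1 ⊗ ρ₂` of `(A₁ ⊗ A₁) ⊗ (A₂ ⊗ A₂)`, transported to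
`(A₁ ⊗ A₂) ⊗ (A₁ ⊗ A₂)` by the reordering `(a ⊗ a') ⊗ (b ⊗ b') ↦ (a ⊗ b) ⊗ (a' ⊗ b')`. -/
def sumMetric {H₁ H₂ : Type*}
    [NormedAddCommGroup H₁] [InnerProductSpace ℂ H₁] [CompleteSpace H₁]
    [NormedAddCommGroup H₂] [InnerProductSpace ℂ H₂] [CompleteSpace H₂]
    (ρ₁ : HilbertTensor H₁ H₁ →L[ℂ] HilbertTensor H₁ H₁)
    (ρ₂ : HilbertTensor H₂ H₂ →L[ℂ] HilbertTensor H₂ H₂) :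
    HilbertTensor (HilbertTensor H₁ H₂) (HilbertTensor H₁ H₂) →L[ℂ]
      HilbertTensor (HilbertTensor H₁ H₂) (HilbertTensor H₁ H₂) :=
  (hinterchange H₁ H₁ H₂ H₂).conjStarAlgEquiv
    (opTensor ρ₁ (ContinuousLinearMap.id ℂ (HilbertTensor H₂ H₂)) +
      opTensor (ContinuousLinearMap.id ℂ (HilbertTensor H₁ H₁)) ρ₂)

end QuantumMetric

end

/-!
The quantum metric axioms leave only classical metrics. If `u` and `v` lie in one irreducible
summand of `π`, then `ρ` vanishes at `v ⊗ v`, and the triangle inequality, tested at `v ⊗ v ⊗ u`,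
forces `ρ (u ⊗ v) = 0`. By (iii) the antisymmetric vector `u ⊗ v - v ⊗ u`, which is orthogonal to
`H_δ`, is then zero, so `u` and `v` are proportional: every irreducible summand is a line. Hence
`H` has a basis `b` in which `π(A)` is diagonal, `ρ` is diagonal in the basis `b i ⊗ b j`, and the
axioms (i)-(v) say precisely that its eigenvalues `d i j` form a metric on the index set. In these
terms `ρ₁ ⊗ 1 + 1 ⊗ ρ₂` is the `ℓ¹` product of two metrics.
-/

noncomputable section

namespace QuantumMetric

open scoped ComplexOrder
open InnerProductSpace (rankOne)

section TensorVectors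

variable {H K L : Type*}
  [NormedAddCommGroup H] [InnerProductSpace ℂ H]
  [NormedAddCommGroup K] [InnerProductSpace ℂ K]
  [NormedAddCommGroup L] [InnerProductSpace ℂ L]

/-- The elementary tensor `htmul x y` as a continuous bilinear map. -/
def htmulL (H K : Type*) [NormedAddCommGroup H] [InnerProductSpace ℂ H]
    [NormedAddCommGroup K] [InnerProductSpace ℂ K] : H →L[ℂ] K →L[ℂ] HilbertTensor H K :=
  (ContinuousLinearMap.compL ℂ K (H ⊗[ℂ] K) (HilbertTensor H K)
    (emb H K).toContinuousLinearMap).comp (TensorProduct.mkL ℂ H K)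

theorem htmulL_apply (x : H) (y : K) : htmulL H K x y = htmul x y := rfl

theorem add_htmul (x x' : H) (y : K) : htmul (x + x') y = htmul x y + htmul x' y := by
  simp [← htmulL_apply]

theorem htmul_add (x : H) (y y' : K) : htmul x (y + y') = htmul x y + htmul x y' := by
  simp [← htmulL_apply]

theorem smul_htmul (c : ℂ) (x : H) (y : K) : htmul (c • x) y = c • htmul x y := by
  simp [← htmulL_apply]

theorem htmul_smul (c : ℂ) (x : H) (y : K) : htmul x (c • y) = c • htmul x y := by
  simp [← htmulL_apply]

theorem zero_htmul (y : K) : htmul (0 : H) y = 0 := by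
  simp [← htmulL_apply]

theorem ext_htmul {S T : HilbertTensor H K →L[ℂ] L}
    (h : ∀ x y, S (htmul x y) = T (htmul x y)) : S = T := by
  refine DFunLike.coe_injective (denseRange_emb.equalizer S.continuous T.continuous ?_)
  funext z
  induction z with
  | zero => simp
  | tmul x y => exact h x y
  | add a b ha hb => simp only [Function.comp_apply, map_add] at ha hb ⊢; rw [ha, hb]

theorem ext_htmul_htmul {M N : Type*} [NormedAddCommGroup M] [InnerProductSpace ℂ M]
    [NormedAddCommGroup N] [InnerProductSpace ℂ N]
    {S T : HilbertTensor (HilbertTensor H K) (HilbertTensor L M) →L[ℂ] N}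
    (h : ∀ x y z w, S (htmul (htmul x y) (htmul z w)) = T (htmul (htmul x y) (htmul z w))) :
    S = T := by
  refine ext_htmul fun u v => ?_
  have hxy : ∀ x y, S ∘L htmulL _ _ (htmul x y) = T ∘L htmulL _ _ (htmul x y) :=
    fun x y => ext_htmul (h x y)
  have hv : S ∘L (htmulL _ _).flip v = T ∘L (htmulL _ _).flip v :=
    ext_htmul fun x y => DFunLike.congr_fun (hxy x y) v
  exact DFunLike.congr_fun hv u

theorem ext_htmul_of_dense_span {s : Set H} {t : Set K}
    (hs : Dense (Submodule.span ℂ s : Set H)) (ht : Dense (Submodule.span ℂ t : Set K))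
    {S T : HilbertTensor H K →L[ℂ] L}
    (h : ∀ x ∈ s, ∀ y ∈ t, S (htmul x y) = T (htmul x y)) : S = T := by
  have hy : ∀ x ∈ s, S ∘L htmulL H K x = T ∘L htmulL H K x := fun x hx =>
    ContinuousLinearMap.ext_on ht fun y hy => h x hx y hy
  refine ext_htmul fun x y => ?_
  have hx : S ∘L (htmulL H K).flip y = T ∘L (htmulL H K).flip y :=
    ContinuousLinearMap.ext_on hs fun x hx => DFunLike.congr_fun (hy x hx) y
  exact DFunLike.congr_fun hx x

end TensorVectors

section HilbertBasis

variable {ι κ H K L : Type*}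
  [NormedAddCommGroup H] [InnerProductSpace ℂ H]
  [NormedAddCommGroup K] [InnerProductSpace ℂ K]
  [NormedAddCommGroup L] [InnerProductSpace ℂ L]
  (b : HilbertBasis ι ℂ H) (c : HilbertBasis κ ℂ K)

theorem inner_hilbertBasis_self (i : ι) : inner ℂ (b i) (b i) = (1 : ℂ) :=
  inner_self_eq_one_of_norm_eq_one (b.orthonormal.1 i)

theorem dense_span_hilbertBasis : Dense (Submodule.span ℂ (Set.range b) : Set H) :=
  Submodule.dense_iff_topologicalClosure_eq_top.2 b.dense_span

theorem ext_hilbertBasis {S T : H →L[ℂ] L} (h : ∀ i, S (b i) = T (b i)) : S = T :=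
  ContinuousLinearMap.ext_on (dense_span_hilbertBasis b) (by rintro _ ⟨i, rfl⟩; exact h i)

theorem eq_zero_of_inner_hilbertBasis {z : H} (h : ∀ i, inner ℂ (b i) z = 0) : z = 0 :=
  b.repr.injective (by ext i; simpa [b.repr_apply_apply] using h i)

theorem orthonormal_htmul : Orthonormal ℂ fun p : ι × κ => htmul (b p.1) (c p.2) := by
  classical
  rw [orthonormal_iff_ite]
  rintro ⟨i, j⟩ ⟨k, l⟩
  simp only [inner_htmul, orthonormal_iff_ite.1 b.orthonormal,
    orthonormal_iff_ite.1 c.orthonormal, Prod.mk.injEq]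
  split_ifs <;> simp_all

/-- The tensor product of two Hilbert bases. -/
def tensorBasis : HilbertBasis (ι × κ) ℂ (HilbertTensor H K) :=
  HilbertBasis.mkOfOrthogonalEqBot (orthonormal_htmul b c) <| by
    rw [Submodule.eq_bot_iff]
    intro z hz
    have hz0 : innerSL ℂ z = 0 := by
      refine ext_htmul_of_dense_span (dense_span_hilbertBasis b) (dense_span_hilbertBasis c) ?_
      rintro _ ⟨i, rfl⟩ _ ⟨j, rfl⟩
      exact (Submodule.mem_orthogonal' _ _).1 hz _ (Submodule.subset_span ⟨(i, j), rfl⟩)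
    exact inner_self_eq_zero.1 (DFunLike.congr_fun hz0 z)

theorem tensorBasis_apply (p : ι × κ) : tensorBasis b c p = htmul (b p.1) (c p.2) := by
  simp [tensorBasis]

variable {b} in
theorem inner_hilbertBasis_apply {T : H →L[ℂ] H} {d : ι → ℂ} (hT : ∀ i, T (b i) = d i • b i)
    (i : ι) (x : H) : inner ℂ (b i) (T x) = d i * inner ℂ (b i) x := by
  classical
  have h : innerSL ℂ (b i) ∘L T = d i • innerSL ℂ (b i) := ext_hilbertBasis b fun j => by
    simp only [ContinuousLinearMap.comp_apply, hT, innerSL_apply_apply, inner_smul_right,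
      smul_apply, smul_eq_mul, orthonormal_iff_ite.1 b.orthonormal]
    split_ifs with h <;> simp [h]
  exact DFunLike.congr_fun h x

variable {b} in
theorem nonneg_iff_of_apply_hilbertBasis [CompleteSpace H] {T : H →L[ℂ] H} {d : ι → ℝ}
    (hT : ∀ i, T (b i) = (d i : ℂ) • b i) : 0 ≤ T ↔ ∀ i, 0 ≤ d i := by
  rw [ContinuousLinearMap.nonneg_iff_isPositive]
  refine ⟨fun h i => ?_, fun hd => ContinuousLinearMap.isPositive_iff_complex T |>.2 fun x => ?_⟩
  · have hi := h.inner_nonneg_right (b i)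
    rw [hT, inner_smul_right, inner_hilbertBasis_self, mul_one] at hi
    exact_mod_cast hi
  · have hterm : ∀ i, 0 ≤ inner ℂ (T x) (b i) * inner ℂ (b i) x := fun i => by
      rw [← inner_conj_symm, inner_hilbertBasis_apply hT, map_mul, Complex.conj_ofReal, mul_assoc,
        RCLike.conj_mul]
      exact mul_nonneg (Complex.zero_le_real.2 (hd i)) (by positivity)
    have hsum : 0 ≤ inner ℂ (T x) x := (b.hasSum_inner_mul_inner (T x) x).nonneg hterm
    exact ⟨(Complex.eq_re_of_ofReal_le hsum).symm, (Complex.le_def.1 hsum).1⟩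

end HilbertBasis

section TensorOperators

variable {H K L M : Type*}
  [NormedAddCommGroup H] [InnerProductSpace ℂ H]
  [NormedAddCommGroup K] [InnerProductSpace ℂ K]
  [NormedAddCommGroup L] [InnerProductSpace ℂ L]
  [NormedAddCommGroup M] [InnerProductSpace ℂ M]

theorem opTensor_mul (S S' : H →L[ℂ] H) (T T' : K →L[ℂ] K) :
    opTensor (S * S') (T * T') = opTensor S T * opTensor S' T' :=
  ext_htmul fun x y => by simp [opTensor_htmul]

theorem opTensor_one : opTensor (1 : H →L[ℂ] H) (1 : K →L[ℂ] K) = 1 :=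
  ext_htmul fun x y => by simp [opTensor_htmul]

theorem opTensor_add_left (S S' : H →L[ℂ] L) (T : K →L[ℂ] M) :
    opTensor (S + S') T = opTensor S T + opTensor S' T :=
  ext_htmul fun x y => by simp [opTensor_htmul, add_htmul]

theorem opTensor_add_right (S : H →L[ℂ] L) (T T' : K →L[ℂ] M) :
    opTensor S (T + T') = opTensor S T + opTensor S T' :=
  ext_htmul fun x y => by simp [opTensor_htmul, htmul_add]

theorem opTensor_smul_left (c : ℂ) (S : H →L[ℂ] L) (T : K →L[ℂ] M) :
    opTensor (c • S) T = c • opTensor S T :=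
  ext_htmul fun x y => by simp [opTensor_htmul, smul_htmul]

theorem opTensor_smul_right (c : ℂ) (S : H →L[ℂ] L) (T : K →L[ℂ] M) :
    opTensor S (c • T) = c • opTensor S T :=
  ext_htmul fun x y => by simp [opTensor_htmul, htmul_smul]

theorem opTensor_rankOne (x : H) (y : K) :
    opTensor (rankOne ℂ x x) (rankOne ℂ y y) = rankOne ℂ (htmul x y) (htmul x y) :=
  ext_htmul fun x' y' => by
    simp [opTensor_htmul, inner_htmul, smul_htmul, htmul_smul, smul_smul, mul_comm]

variable [CompleteSpace H] [CompleteSpace K]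

theorem star_opTensor (S : H →L[ℂ] H) (T : K →L[ℂ] K) :
    star (opTensor S T) = opTensor (star S) (star T) := by
  refine ext_htmul fun x y => ext_inner_right ℂ fun z => ?_
  refine DFunLike.congr_fun (f := innerSL ℂ (star (opTensor S T) (htmul x y)))
    (g := innerSL ℂ (opTensor (star S) (star T) (htmul x y))) (ext_htmul fun x' y' => ?_) z
  simp only [innerSL_apply_apply, ContinuousLinearMap.star_eq_adjoint,
    ContinuousLinearMap.adjoint_inner_left, opTensor_htmul, inner_htmul]

/-- The amplification `T ↦ T ⊗ 1` as a morphism of star algebras. -/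
def amplifyLeft (H K : Type*) [NormedAddCommGroup H] [InnerProductSpace ℂ H] [CompleteSpace H]
    [NormedAddCommGroup K] [InnerProductSpace ℂ K] [CompleteSpace K] :
    (H →L[ℂ] H) →⋆ₐ[ℂ] (HilbertTensor H K →L[ℂ] HilbertTensor H K) where
  toFun T := opTensor T 1
  map_one' := opTensor_one
  map_mul' S T := by rw [← opTensor_mul, one_mul]
  map_zero' := by simpa using opTensor_smul_left (0 : ℂ) (0 : H →L[ℂ] H) (1 : K →L[ℂ] K)
  map_add' S T := opTensor_add_left S T 1
  commutes' c := by simp only [Algebra.algebraMap_eq_smul_one, opTensor_smul_left, opTensor_one]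
  map_star' T := by rw [star_opTensor, star_one]

/-- The amplification `T ↦ 1 ⊗ T` as a morphism of star algebras. -/
def amplifyRight (H K : Type*) [NormedAddCommGroup H] [InnerProductSpace ℂ H] [CompleteSpace H]
    [NormedAddCommGroup K] [InnerProductSpace ℂ K] [CompleteSpace K] :
    (K →L[ℂ] K) →⋆ₐ[ℂ] (HilbertTensor H K →L[ℂ] HilbertTensor H K) where
  toFun T := opTensor 1 T
  map_one' := opTensor_one
  map_mul' S T := by rw [← opTensor_mul, one_mul]
  map_zero' := by simpa using opTensor_smul_right (0 : ℂ) (1 : H →L[ℂ] H) (0 : K →L[ℂ] K)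
  map_add' S T := opTensor_add_right 1 S T
  commutes' c := by simp only [Algebra.algebraMap_eq_smul_one, opTensor_smul_right, opTensor_one]
  map_star' T := by rw [star_opTensor, star_one]

end TensorOperators

section Schur

variable {A : Type*} [CStarAlgebra A]
  {E F : Type*} [NormedAddCommGroup E] [InnerProductSpace ℂ E] [CompleteSpace E]
  [NormedAddCommGroup F] [InnerProductSpace ℂ F] [CompleteSpace F]
  {σ : A →⋆ₐ[ℂ] (E →L[ℂ] E)} {τ : A →⋆ₐ[ℂ] (F →L[ℂ] F)}

theorem cfc_ne_zero_of_mem_spectrum {a : A} (ha : IsSelfAdjoint a) {f : ℝ → ℝ} (hf : Continuous f)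
    {t : ℝ} (ht : t ∈ spectrum ℝ a) (hft : f t ≠ 0) : cfc f a ≠ 0 := fun h =>
  hft <| (cfc_eq_cfc_iff_eqOn (g := 0) ha hf.continuousOn
    continuous_zero.continuousOn).1 (by rw [h, cfc_zero]) ht

theorem exists_cfc_mul_cfc_eq_zero {a : A} (ha : IsSelfAdjoint a) {s t : ℝ}
    (hs : s ∈ spectrum ℝ a) (ht : t ∈ spectrum ℝ a) (hst : s < t) :
    ∃ f g : ℝ → ℝ, cfc f a ≠ 0 ∧ cfc g a ≠ 0 ∧ cfc f a * cfc g a = 0 := by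
  let f : ℝ → ℝ := fun r => max (r - (s + t) / 2) 0
  let g : ℝ → ℝ := fun r => max ((s + t) / 2 - r) 0
  have hf : Continuous f := by fun_prop
  have hg : Continuous g := by fun_prop
  refine ⟨f, g, cfc_ne_zero_of_mem_spectrum ha hf ht ?_,
    cfc_ne_zero_of_mem_spectrum ha hg hs ?_, ?_⟩
  · simp only [f, ne_eq, max_eq_right_iff, not_le]; linarith
  · simp only [g, ne_eq, max_eq_right_iff, not_le]; linarith
  · rw [← cfc_mul f g a hf.continuousOn hg.continuousOn, ← cfc_zero ℝ a]
    refine cfc_congr fun r _ => ?_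
    rcases le_total r ((s + t) / 2) with h | h <;> simp [f, g, max_eq_right (sub_nonpos.2 h)]

theorem inner_map_star_apply (σ : A →⋆ₐ[ℂ] (E →L[ℂ] E)) (a : A) (x y : E) :
    inner ℂ (σ (star a) x) y = inner ℂ x (σ a y) := by
  rw [map_star, ContinuousLinearMap.star_eq_adjoint, ContinuousLinearMap.adjoint_inner_left]

theorem IsIrreducibleRep.injective_or_eq_zero (hσ : IsIrreducibleRep σ) {T : E →L[ℂ] F}
    (hT : ∀ a x, T (σ a x) = τ a (T x)) : Function.Injective T ∨ T = 0 := by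
  refine (hσ.2 T.ker T.isClosed_ker fun a x hx => ?_).imp LinearMap.ker_eq_bot.1 fun h => ?_
  · rw [LinearMap.mem_ker] at hx ⊢
    exact (hT a x).trans (by rw [show T x = 0 from hx, map_zero])
  · exact ContinuousLinearMap.ext fun x => LinearMap.mem_ker.1 (h ▸ Submodule.mem_top)

theorem IsIrreducibleRep.exists_eq_real_smul_one (hσ : IsIrreducibleRep σ) {T : E →L[ℂ] E}
    (hsa : IsSelfAdjoint T) (hT : ∀ a, Commute (σ a) T) : ∃ c : ℝ, T = c • 1 := by
  have hlt : ∀ s ∈ spectrum ℝ T, ∀ t ∈ spectrum ℝ T, ¬ s < t := by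
    intro s hs t ht hst
    obtain ⟨f, g, hf, hg, hfg⟩ := exists_cfc_mul_cfc_eq_zero hsa hs ht hst
    have hcomm : ∀ a x, cfc f T (σ a x) = σ a (cfc f T x) := fun a x =>
      DFunLike.congr_fun (Commute.cfc (hT a).symm (by rw [hsa.star_eq]; exact (hT a).symm) f).eq x
    rcases hσ.injective_or_eq_zero hcomm with hinj | h0
    · exact hg (ContinuousLinearMap.ext fun x => hinj (by simpa using DFunLike.congr_fun hfg x))
    · exact hf h0
  have := hσ.1
  obtain ⟨c, hc⟩ : (spectrum ℝ T).Nonempty :=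
    ContinuousFunctionalCalculus.spectrum_nonempty (R := ℝ) T hsa
  refine ⟨c, ?_⟩
  rw [← Algebra.algebraMap_eq_smul_one]
  exact CFC.eq_algebraMap_of_spectrum_subset_singleton T c
    fun t ht => le_antisymm (not_lt.1 (hlt c hc t ht)) (not_lt.1 (hlt t ht c hc))

theorem IsIrreducibleRep.exists_eq_smul_one (hσ : IsIrreducibleRep σ) {T : E →L[ℂ] E}
    (hT : ∀ a, Commute (σ a) T) : ∃ c : ℂ, T = c • 1 := by
  have hT' : ∀ a, Commute (σ a) (star T) := fun a => by
    simpa only [← map_star, star_star] using (hT (star a)).star_star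
  obtain ⟨c, hc⟩ := hσ.exists_eq_real_smul_one (realPart T).2 fun a => by
    rw [realPart_apply_coe]
    exact ((hT a).add_right (hT' a)).smul_right _
  obtain ⟨d, hd⟩ := hσ.exists_eq_real_smul_one (imaginaryPart T).2 fun a => by
    rw [imaginaryPart_apply_coe]
    exact (((hT a).sub_right (hT' a)).smul_right _).smul_right _
  refine ⟨c + Complex.I * d, ?_⟩
  rw [← realPart_add_I_smul_imaginaryPart T, hc, hd, add_smul, mul_smul, Complex.coe_smul,
    Complex.coe_smul]

theorem IsIrreducibleRep.exists_norm_eq_mul_norm (hσ : IsIrreducibleRep σ) {S : E →L[ℂ] F}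
    (hS : ∀ a x, S (σ a x) = τ a (S x)) : ∃ r : ℝ, ∀ x, ‖S x‖ = r * ‖x‖ := by
  have hadj : ∀ a y, S.adjoint (τ a y) = σ a (S.adjoint y) := fun a y => by
    refine ext_inner_left ℂ fun x => ?_
    rw [ContinuousLinearMap.adjoint_inner_right, ← inner_map_star_apply, ← inner_map_star_apply,
      ContinuousLinearMap.adjoint_inner_right, hS]
  obtain ⟨c, hc⟩ := hσ.exists_eq_real_smul_one (T := S.adjoint ∘L S)
    (ContinuousLinearMap.isPositive_adjoint_comp_self S).isSelfAdjoint
    fun a => ContinuousLinearMap.ext fun x => by simp [hS, hadj]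
  refine ⟨√c, fun x => ?_⟩
  have hsq : ‖S x‖ ^ 2 = c * ‖x‖ ^ 2 := by
    rw [ContinuousLinearMap.apply_norm_sq_eq_inner_adjoint_right, hc, smul_apply,
      one_apply_eq_self, inner_smul_right_eq_smul, RCLike.smul_re, inner_self_eq_norm_sq]
  rw [← Real.sqrt_sq (norm_nonneg (S x)), hsq, Real.sqrt_mul' _ (sq_nonneg _),
    Real.sqrt_sq (norm_nonneg x)]

theorem IsIrreducibleRep.equivalentReps (hσ : IsIrreducibleRep σ) (hτ : IsIrreducibleRep τ)
    {S : E →L[ℂ] F} (hS : ∀ a x, S (σ a x) = τ a (S x)) (hS0 : S ≠ 0) : EquivalentReps σ τ := by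
  obtain ⟨r, hr⟩ := hσ.exists_norm_eq_mul_norm hS
  obtain ⟨x₀, hx₀⟩ : ∃ x, S x ≠ 0 := by
    by_contra! h
    exact hS0 (ContinuousLinearMap.ext h)
  have hr0 : 0 < r := pos_of_mul_pos_left (hr x₀ ▸ norm_pos_iff.2 hx₀) (norm_nonneg x₀)
  let W : E →ₗᵢ[ℂ] F :=
    { ((r⁻¹ : ℂ) • S).toLinearMap with
      norm_map' := fun x => by simp [norm_smul, hr, abs_of_pos hr0, hr0.ne'] }
  have hW : ∀ a x, W (σ a x) = τ a (W x) := fun a x =>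
    show (r⁻¹ : ℂ) • S (σ a x) = τ a ((r⁻¹ : ℂ) • S x) by rw [hS, map_smul]
  have hsurj : Function.Surjective W := by
    rcases hτ.2 W.range W.isometry.isClosedEmbedding.isClosed_range
      (by rintro a _ ⟨x, rfl⟩; exact ⟨σ a x, hW a x⟩) with h | h
    · have hW0 : W x₀ = 0 := (Submodule.mem_bot ℂ).1 (h ▸ ⟨x₀, rfl⟩)
      exact absurd (W.injective (hW0.trans (map_zero W).symm)) fun h0 => hx₀ (by rw [h0, map_zero])
    · exact LinearMap.range_eq_top.1 h
  exact ⟨LinearIsometryEquiv.ofSurjective W hsurj, hW⟩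

end Schur

section RankOne

variable {H : Type*} [NormedAddCommGroup H] [InnerProductSpace ℂ H] [CompleteSpace H]

theorem commute_rankOne {T : H →L[ℂ] H} {v : H} {c d : ℂ} (hc : T v = c • v)
    (hd : star T v = d • v) : Commute T (rankOne ℂ v v) := by
  have hz : ∀ z, inner ℂ v (T z) = starRingEnd ℂ d * inner ℂ v z := fun z => by
    rw [← ContinuousLinearMap.adjoint_inner_left, ← ContinuousLinearMap.star_eq_adjoint, hd,
      inner_smul_left]
  have hcd : c • v = starRingEnd ℂ d • v := by
    rcases eq_or_ne v 0 with rfl | hv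
    · simp
    · have hvv := hz v
      rw [hc, inner_smul_right] at hvv
      rw [mul_right_cancel₀ (inner_self_ne_zero.2 hv) hvv]
  ext z
  rw [mul_apply_eq_comp, mul_apply_eq_comp, InnerProductSpace.rankOne_apply,
    InnerProductSpace.rankOne_apply, map_smul, hc, hz, hcd, smul_smul, mul_comm]

theorem eq_zero_or_eq_rankOne_of_le {v : H} (hv : ‖v‖ = 1) {q : H →L[ℂ] H}
    (hq : IsStarProjection q) (hle : q ≤ rankOne ℂ v v) : q = 0 ∨ q = rankOne ℂ v v := by
  have hp := InnerProductSpace.isStarProjection_rankOne_self (𝕜 := ℂ) hv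
  have hv0 : v ≠ 0 := norm_ne_zero_iff.1 (by rw [hv]; exact one_ne_zero)
  have hpq : rankOne ℂ v v * q = q := ((hq.le_tfae hp).out 0 1).1 hle
  have hqp : q * rankOne ℂ v v = q := ((hq.le_tfae hp).out 0 2).1 hle
  obtain ⟨c, hc⟩ : ∃ c : ℂ, q = c • rankOne ℂ v v := by
    refine ⟨inner ℂ v (q v), ContinuousLinearMap.ext fun z => ?_⟩
    conv_lhs => rw [← hpq, ← hqp]
    simp [smul_smul, mul_comm]
  have hcc : c * c = c := by
    have hqq := hq.isIdempotentElem.eq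
    rw [hc, smul_mul_smul_comm, hp.isIdempotentElem.eq] at hqq
    exact smul_left_injective ℂ (InnerProductSpace.rankOne_ne_zero hv0 hv0) hqq
  rcases IsIdempotentElem.iff_eq_zero_or_one.1 hcc with rfl | rfl
  · exact .inl (hc.trans (zero_smul ℂ _))
  · exact .inr (hc.trans (one_smul ℂ _))

end RankOne

section AtomicVectors

variable {A : Type*} [CStarAlgebra A]
  {H : Type*} [NormedAddCommGroup H] [InnerProductSpace ℂ H] [CompleteSpace H]
  {π : A →⋆ₐ[ℂ] (H →L[ℂ] H)} {v : H} {p : H →L[ℂ] H}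

/-- The joint eigenvectors of the commutant `π(A)'`: by `rankOne_mem_envelopingAlgebra`, vectors `v`
for which `π(A)''` contains the projection onto `ℂ v`. For an atomic representation they are the
vectors lying in one of the irreducible summands. -/
def atomicVectors (π : A →⋆ₐ[ℂ] (H →L[ℂ] H)) : Set H :=
  {v | ∀ T ∈ Set.centralizer (Set.range π), ∃ c : ℂ, T v = c • v}

theorem smul_mem_atomicVectors (c : ℂ) (hv : v ∈ atomicVectors π) : c • v ∈ atomicVectors π :=
  fun T hT => (hv T hT).imp fun d hd => by rw [map_smul, hd, smul_comm]

theorem apply_mem_atomicVectors (hp : p ∈ envelopingAlgebra π) (hv : v ∈ atomicVectors π) :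
    p v ∈ atomicVectors π := fun T hT => (hv T hT).imp fun c hc => by
  rw [← mul_apply_eq_comp, hp T hT, mul_apply_eq_comp, hc, map_smul]

theorem star_mem_centralizer_range {T : H →L[ℂ] H} (hT : T ∈ Set.centralizer (Set.range π)) :
    star T ∈ Set.centralizer (Set.range π) :=
  Set.star_mem_centralizer' (by rintro _ ⟨a, rfl⟩; exact ⟨star a, map_star π a⟩) hT

theorem rankOne_mem_envelopingAlgebra (hv : v ∈ atomicVectors π) :
    rankOne ℂ v v ∈ envelopingAlgebra π := by
  intro T hT
  obtain ⟨c, hc⟩ := hv T hT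
  obtain ⟨d, hd⟩ := hv (star T) (star_mem_centralizer_range hT)
  exact commute_rankOne hc hd

theorem isMinimalProjection_rankOne (hv : v ∈ atomicVectors π) (hv1 : ‖v‖ = 1) :
    IsMinimalProjection (envelopingAlgebra π) (rankOne ℂ v v) := by
  have hv0 : v ≠ 0 := norm_ne_zero_iff.1 (by rw [hv1]; exact one_ne_zero)
  exact ⟨rankOne_mem_envelopingAlgebra hv, InnerProductSpace.isStarProjection_rankOne_self hv1,
    InnerProductSpace.rankOne_ne_zero hv0 hv0,
    fun q _ hq hle => eq_zero_or_eq_rankOne_of_le hv1 hq hle⟩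

section Dense

variable (hπ : Dense (Submodule.span ℂ (atomicVectors π) : Set H))
include hπ

theorem exists_eq_rankOne_of_isMinimalProjection
    (hp : IsMinimalProjection (envelopingAlgebra π) p) :
    ∃ v ∈ atomicVectors π, ‖v‖ = 1 ∧ p = rankOne ℂ v v := by
  obtain ⟨hpN, hproj, hp0, hmin⟩ := hp
  obtain ⟨v, hv, hpv⟩ : ∃ v ∈ atomicVectors π, p v ≠ 0 := by
    by_contra! hall
    exact hp0 (ContinuousLinearMap.ext_on hπ hall)
  have hu : ‖(‖p v‖⁻¹ : ℂ) • p v‖ = 1 := norm_smul_inv_norm hpv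
  have huS := smul_mem_atomicVectors (‖p v‖⁻¹ : ℂ) (apply_mem_atomicVectors hpN hv)
  have hmem := isMinimalProjection_rankOne huS hu
  refine ⟨_, huS, hu, ((hmin _ hmem.1 hmem.2.1 ?_).resolve_left hmem.2.2.1).symm⟩
  have hppv : p (p v) = p v := by rw [← mul_apply_eq_comp, hproj.isIdempotentElem.eq]
  refine ((hmem.2.1.le_tfae hproj).out 0 1).2 (ContinuousLinearMap.ext fun z => ?_)
  simp [hppv]

theorem diagonalSubspace_eq : diagonalSubspace π =
    (Submodule.span ℂ ((fun v => htmul v v) '' atomicVectors π)).topologicalClosure := by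
  rw [diagonalSubspace]
  congr 1
  refine le_antisymm (iSup_le ?_) (Submodule.span_le.2 ?_)
  · rintro ⟨p, hp⟩
    obtain ⟨v, hv, -, rfl⟩ := exists_eq_rankOne_of_isMinimalProjection hπ hp
    rintro _ ⟨z, rfl⟩
    simp only [opTensor_rankOne, ContinuousLinearMap.coe_coe, InnerProductSpace.rankOne_apply]
    exact Submodule.smul_mem _ _ (Submodule.subset_span ⟨v, hv, rfl⟩)
  · rintro _ ⟨v, hv, rfl⟩
    rcases eq_or_ne v 0 with rfl | hv0
    · simp [zero_htmul]
    have hp := isMinimalProjection_rankOne (smul_mem_atomicVectors (‖v‖⁻¹ : ℂ) hv)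
      (norm_smul_inv_norm hv0)
    have hpv : rankOne ℂ ((‖v‖⁻¹ : ℂ) • v) ((‖v‖⁻¹ : ℂ) • v) v = v := by
      have hn : (‖v‖ : ℂ) ≠ 0 := Complex.ofReal_ne_zero.2 (norm_ne_zero_iff.2 hv0)
      simp only [InnerProductSpace.rankOne_apply, inner_smul_left, inner_self_eq_norm_sq_to_K,
        smul_smul, map_inv₀, Complex.conj_ofReal, Complex.coe_algebraMap]
      rw [show ((‖v‖ : ℂ)⁻¹ * (‖v‖ : ℂ) ^ 2) * (‖v‖ : ℂ)⁻¹ = 1 by field_simp, one_smul]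
    refine Submodule.mem_iSup_of_mem ⟨_, hp⟩ ⟨htmul v v, ?_⟩
    simp only [ContinuousLinearMap.coe_coe, opTensor_htmul, hpv]

theorem mul_diagonalProjection_eq_zero_iff {T : HilbertTensor H H →L[ℂ] HilbertTensor H H} :
    T * diagonalProjection π = 0 ↔ ∀ v ∈ atomicVectors π, T (htmul v v) = 0 := by
  constructor
  · intro hT v hv
    have hmem : htmul v v ∈ diagonalSubspace π := by
      rw [diagonalSubspace_eq hπ]
      exact Submodule.le_topologicalClosure _ (Submodule.subset_span ⟨v, hv, rfl⟩)
    rw [← Submodule.starProjection_eq_self_iff.2 hmem]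
    exact DFunLike.congr_fun hT (htmul v v)
  · intro hT
    have hle : diagonalSubspace π ≤ T.ker := by
      rw [diagonalSubspace_eq hπ]
      refine Submodule.topologicalClosure_minimal _ (Submodule.span_le.2 ?_) T.isClosed_ker
      rintro _ ⟨v, hv, rfl⟩
      exact hT v hv
    exact ContinuousLinearMap.ext fun z => hle (Submodule.starProjection_apply_mem _ z)

theorem mem_orthogonal_diagonalSubspace_iff {z : HilbertTensor H H} :
    z ∈ (diagonalSubspace π)ᗮ ↔ ∀ v ∈ atomicVectors π, inner ℂ (htmul v v) z = 0 := by
  rw [diagonalSubspace_eq hπ, Submodule.orthogonal_closure, ← Submodule.span_singleton_le_iff_mem,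
    ← Submodule.isOrtho_iff_le, Submodule.isOrtho_comm, Submodule.isOrtho_span]
  simp

end Dense

end AtomicVectors

section Decomposition

universe u v

/-- The isometries `V i : E i → H` exhibit the representation `π` as the Hilbert sum of the
pairwise inequivalent irreducible representations `σ i`. -/
structure IsAtomicDecomposition {A H ι : Type*} [CStarAlgebra A] [NormedAddCommGroup H]
    [InnerProductSpace ℂ H] [CompleteSpace H] {E : ι → Type*} [∀ i, NormedAddCommGroup (E i)]
    [∀ i, InnerProductSpace ℂ (E i)] [∀ i, CompleteSpace (E i)] (π : A →⋆ₐ[ℂ] (H →L[ℂ] H))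
    (σ : ∀ i, A →⋆ₐ[ℂ] (E i →L[ℂ] E i)) (V : ∀ i, E i →ₗᵢ[ℂ] H) : Prop where
  irreducible : ∀ i, IsIrreducibleRep (σ i)
  inequivalent : ∀ i j, i ≠ j → ¬ EquivalentReps (σ i) (σ j)
  orthogonal : OrthogonalFamily ℂ E V
  total : ∀ z : H, (∀ i x, inner ℂ (V i x) z = 0) → z = 0
  intertwine : ∀ i a x, π a (V i x) = V i (σ i a x)

theorem IsAtomicRep.exists_isAtomicDecomposition {A : Type v} [CStarAlgebra A] {H : Type u}
    [NormedAddCommGroup H] [InnerProductSpace ℂ H] [CompleteSpace H]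
    {π : A →⋆ₐ[ℂ] (H →L[ℂ] H)} (h : IsAtomicRep π) :
    ∃ (ι : Type u) (E : ι → Type u)
      (_ : ∀ i, NormedAddCommGroup (E i)) (_ : ∀ i, InnerProductSpace ℂ (E i))
      (_ : ∀ i, CompleteSpace (E i)) (σ : ∀ i, A →⋆ₐ[ℂ] (E i →L[ℂ] E i))
      (V : ∀ i, E i →ₗᵢ[ℂ] H), IsAtomicDecomposition π σ V := by
  classical
  obtain ⟨ι, E, _, _, _, σ, hirr, hineq, U, hU⟩ := h
  let V : ∀ i, E i →ₗᵢ[ℂ] H := fun i => U.symm.toLinearIsometry.comp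
    { lp.lsingle (𝕜 := ℂ) (E := E) 2 i with
      norm_map' := fun x => lp.norm_single (E := E) (p := 2) (by norm_num) i x }
  have hUV : ∀ i x, U (V i x) = lp.single 2 i x := fun i x => U.apply_symm_apply _
  have hinner : ∀ i x z, inner ℂ (V i x) z = inner ℂ x (U z i) := fun i x z => by
    rw [← lp.inner_single_left, ← hUV, LinearIsometryEquiv.inner_map_map]
  refine ⟨ι, E, _, _, _, σ, V, hirr, hineq, fun i j hij x y => ?_, fun z hz => ?_,
    fun i a x => U.injective (lp.ext (funext fun j => ?_))⟩
  · rw [hinner, hUV, lp.single_apply_ne _ _ _ hij, inner_zero_right]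
  · refine (map_eq_zero_iff U U.injective).1 (lp.ext (funext fun i => ?_))
    exact ext_inner_left ℂ fun x => by rw [← hinner, hz]; simp
  · rw [hU, hUV, hUV]
    rcases eq_or_ne j i with rfl | hij
    · rw [lp.single_apply_self, lp.single_apply_self]
    · rw [lp.single_apply_ne _ _ _ hij, lp.single_apply_ne _ _ _ hij, map_zero]

namespace IsAtomicDecomposition

section IsAtomicRep

variable {A : Type v} [CStarAlgebra A] {H ι : Type u} [NormedAddCommGroup H]
  [InnerProductSpace ℂ H] [CompleteSpace H] {E : ι → Type u} [∀ i, NormedAddCommGroup (E i)]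
  [∀ i, InnerProductSpace ℂ (E i)] [∀ i, CompleteSpace (E i)]
  {π : A →⋆ₐ[ℂ] (H →L[ℂ] H)} {σ : ∀ i, A →⋆ₐ[ℂ] (E i →L[ℂ] E i)} {V : ∀ i, E i →ₗᵢ[ℂ] H}

theorem isAtomicRep (h : IsAtomicDecomposition π σ V) : IsAtomicRep π := by
  classical
  have hV : IsHilbertSum ℂ E V := by
    refine IsHilbertSum.mk h.orthogonal (top_le_iff.2 ?_)
    rw [Submodule.topologicalClosure_eq_top_iff, Submodule.eq_bot_iff]
    exact fun z hz => h.total z fun i x => (Submodule.mem_orthogonal _ _).1 hz _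
      (Submodule.mem_iSup_of_mem i ⟨x, rfl⟩)
  have hinner : ∀ i x z, inner ℂ x (hV.linearIsometryEquiv z i) = inner ℂ (V i x) z :=
    fun i x z => by
      rw [← lp.inner_single_left, ← hV.linearIsometryEquiv_symm_apply_single,
        ← LinearIsometryEquiv.inner_map_map hV.linearIsometryEquiv.symm,
        LinearIsometryEquiv.symm_apply_apply]
  refine ⟨ι, E, _, _, _, σ, h.irreducible, h.inequivalent, hV.linearIsometryEquiv,
    fun a x i => ext_inner_left ℂ fun y => ?_⟩
  rw [hinner, ← inner_map_star_apply, h.intertwine, ← hinner, inner_map_star_apply]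

end IsAtomicRep

variable {A H ι : Type*} [CStarAlgebra A] [NormedAddCommGroup H]
  [InnerProductSpace ℂ H] [CompleteSpace H] {E : ι → Type*} [∀ i, NormedAddCommGroup (E i)]
  [∀ i, InnerProductSpace ℂ (E i)] [∀ i, CompleteSpace (E i)]
  {π : A →⋆ₐ[ℂ] (H →L[ℂ] H)} {σ : ∀ i, A →⋆ₐ[ℂ] (E i →L[ℂ] E i)} {V : ∀ i, E i →ₗᵢ[ℂ] H}

theorem adjoint_apply (h : IsAtomicDecomposition π σ V) (i : ι) (a : A) (z : H) :
    (V i).toContinuousLinearMap.adjoint (π a z) =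
      σ i a ((V i).toContinuousLinearMap.adjoint z) := by
  refine ext_inner_left ℂ fun x => ?_
  rw [ContinuousLinearMap.adjoint_inner_right, ← inner_map_star_apply, ← inner_map_star_apply,
    ContinuousLinearMap.adjoint_inner_right, LinearIsometry.coe_toContinuousLinearMap,
    h.intertwine]

theorem exists_smul_of_mem_centralizer (h : IsAtomicDecomposition π σ V) {T : H →L[ℂ] H}
    (hT : T ∈ Set.centralizer (Set.range π)) (i : ι) : ∃ c : ℂ, ∀ x, T (V i x) = c • V i x := by
  let S : ∀ j, E i →L[ℂ] E j := fun j =>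
    (V j).toContinuousLinearMap.adjoint ∘L T ∘L (V i).toContinuousLinearMap
  have hinner : ∀ j x y, inner ℂ (V j y) (T (V i x)) = inner ℂ y (S j x) := fun j x y =>
    (ContinuousLinearMap.adjoint_inner_right (V j).toContinuousLinearMap y (T (V i x))).symm
  have hS : ∀ j a x, S j (σ i a x) = σ j a (S j x) := fun j a x => by
    have hTa : T (π a (V i x)) = π a (T (V i x)) := (DFunLike.congr_fun (hT _ ⟨a, rfl⟩) _).symm
    simp only [S, ContinuousLinearMap.comp_apply, LinearIsometry.coe_toContinuousLinearMap,
      ← h.intertwine, hTa, h.adjoint_apply]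
  obtain ⟨c, hc⟩ := (h.irreducible i).exists_eq_smul_one (T := S i) fun a =>
    ContinuousLinearMap.ext fun x => (hS i a x).symm
  refine ⟨c, fun x => sub_eq_zero.1 (h.total _ fun j y => ?_)⟩
  rw [inner_sub_right, hinner]
  rcases eq_or_ne i j with rfl | hij
  · rw [hc, smul_apply, one_apply_eq_self, inner_smul_right, inner_smul_right,
      LinearIsometry.inner_map_map, sub_self]
  · have hSj : S j = 0 := by
      by_contra hne
      exact h.inequivalent i j hij
        ((h.irreducible i).equivalentReps (h.irreducible j) (hS j) hne)
    rw [hSj, inner_smul_right, h.orthogonal hij.symm y x]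
    simp

theorem mem_atomicVectors (h : IsAtomicDecomposition π σ V) (i : ι) (x : E i) :
    V i x ∈ atomicVectors π := fun _ hT =>
  (h.exists_smul_of_mem_centralizer hT i).imp fun _ hc => hc x

end IsAtomicDecomposition

theorem IsAtomicRep.dense_span_atomicVectors {A H : Type*} [CStarAlgebra A]
    [NormedAddCommGroup H] [InnerProductSpace ℂ H] [CompleteSpace H]
    {π : A →⋆ₐ[ℂ] (H →L[ℂ] H)} (h : IsAtomicRep π) :
    Dense (Submodule.span ℂ (atomicVectors π) : Set H) := by
  obtain ⟨ι, E, _, _, _, σ, V, hd⟩ := h.exists_isAtomicDecomposition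
  rw [Submodule.dense_iff_topologicalClosure_eq_top, Submodule.topologicalClosure_eq_top_iff,
    Submodule.eq_bot_iff]
  exact fun z hz => hd.total z fun i x => (Submodule.mem_orthogonal _ _).1 hz _
    (Submodule.subset_span (hd.mem_atomicVectors i x))

end Decomposition

section TriangleOperators

variable {H : Type*} [NormedAddCommGroup H] [InnerProductSpace ℂ H]
  (T : HilbertTensor H H →L[ℂ] HilbertTensor H H)

theorem flip_htmul (x y : H) : flip T (htmul x y) = hcomm H H (T (htmul y x)) := by
  have hsymm : (hcomm H H).symm (htmul x y) = htmul y x := by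
    rw [LinearIsometryEquiv.symm_apply_eq, hcomm_htmul]
  simp [flip, LinearIsometryEquiv.conjStarAlgEquiv_apply, hsymm]

theorem tensorOne_htmul (x y z : H) :
    tensorOne T (htmul (htmul x y) z) = htmul (T (htmul x y)) z := by
  simp [tensorOne, opTensor_htmul]

theorem hassoc_symm_htmul (x y z : H) :
    (hassoc H H H).symm (htmul x (htmul y z)) = htmul (htmul x y) z := by
  rw [LinearIsometryEquiv.symm_apply_eq, hassoc_htmul]

theorem oneTensor_htmul (x y z : H) : oneTensor T (htmul (htmul x y) z) =
    (hassoc H H H).symm (htmul x (T (htmul y z))) := by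
  simp [oneTensor, LinearIsometryEquiv.conjStarAlgEquiv_apply, hassoc_htmul, opTensor_htmul]

theorem midOne_htmul (x y z : H) : midOne T (htmul (htmul x y) z) =
    hrightComm H H H (htmul (T (htmul x z)) y) := by
  have hsymm : (hrightComm H H H).symm (htmul (htmul x y) z) = htmul (htmul x z) y := by
    rw [LinearIsometryEquiv.symm_apply_eq, hrightComm_htmul]
  simp [midOne, LinearIsometryEquiv.conjStarAlgEquiv_apply, hsymm, tensorOne_htmul]

theorem inner_oneTensor_htmul (x y z x' y' z' : H) :
    inner ℂ (htmul (htmul x' y') z') (oneTensor T (htmul (htmul x y) z)) =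
      inner ℂ x' x * inner ℂ (htmul y' z') (T (htmul y z)) := by
  rw [oneTensor_htmul, ← hassoc_symm_htmul, LinearIsometryEquiv.inner_map_map, inner_htmul]

theorem inner_midOne_htmul (x y z x' y' z' : H) :
    inner ℂ (htmul (htmul x' y') z') (midOne T (htmul (htmul x y) z)) =
      inner ℂ (htmul x' z') (T (htmul x z)) * inner ℂ y' y := by
  rw [midOne_htmul, ← hrightComm_htmul x' z' y', LinearIsometryEquiv.inner_map_map, inner_htmul]

end TriangleOperators

section Collapse

theorem apply_eq_zero_of_inner_eq_zero {H : Type*} [NormedAddCommGroup H] [InnerProductSpace ℂ H]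
    [CompleteSpace H] {T : H →L[ℂ] H} (hT : 0 ≤ T) {x : H} (hx : inner ℂ x (T x) = 0) :
    T x = 0 := by
  obtain ⟨S, rfl⟩ := CStarAlgebra.nonneg_iff_eq_star_mul_self.1 hT
  rw [mul_apply_eq_comp, ContinuousLinearMap.star_eq_adjoint,
    ContinuousLinearMap.adjoint_inner_right, inner_self_eq_zero] at hx
  rw [mul_apply_eq_comp, hx, map_zero]

namespace IsCompactQuantumMetricSpace

variable {A : Type*} [CStarAlgebra A]
  {H : Type*} [NormedAddCommGroup H] [InnerProductSpace ℂ H] [CompleteSpace H]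
  {π : A →⋆ₐ[ℂ] (H →L[ℂ] H)} {ρ : HilbertTensor H H →L[ℂ] HilbertTensor H H}
  (h : IsCompactQuantumMetricSpace π ρ)
include h

theorem inner_left_eq_inner_right (x y : HilbertTensor H H) :
    inner ℂ (ρ x) y = inner ℂ x (ρ y) :=
  ((ContinuousLinearMap.nonneg_iff_isPositive ρ).1 h.nonneg).inner_left_eq_inner_right x y

theorem apply_htmul_self {v : H} (hv : v ∈ atomicVectors π) : ρ (htmul v v) = 0 :=
  (mul_diagonalProjection_eq_zero_iff h.atomic.dense_span_atomicVectors).1 h.mul_diagonal v hv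

variable {W : Submodule ℂ H} (hW : (W : Set H) ⊆ atomicVectors π) {u v : H}
include hW

theorem apply_htmul_swap (hu : u ∈ W) (hv : v ∈ W) :
    ρ (htmul v u) = -ρ (htmul u v) := by
  have huv := h.apply_htmul_self (hW (W.add_mem hu hv))
  simp only [add_htmul, htmul_add, map_add, h.apply_htmul_self (hW hu),
    h.apply_htmul_self (hW hv), zero_add, add_zero] at huv
  exact eq_neg_of_add_eq_zero_left huv

/- The positive operator `D = ρ ⊗ 1 + 1 ⊗ ρ - 𝔐(ρ)` has vanishing quadratic form at `v ⊗ v ⊗ u`,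
hence annihilates it; pairing the result with `v ⊗ u ⊗ v` isolates `⟪u ⊗ v, ρ (v ⊗ u)⟫`. -/
theorem apply_htmul_eq_zero (hu : u ∈ W) (hv : v ∈ W) : ρ (htmul u v) = 0 := by
  rcases eq_or_ne v 0 with rfl | hv0
  · rw [← htmulL_apply, map_zero, map_zero]
  have hvv : ρ (htmul v v) = 0 := h.apply_htmul_self (hW hv)
  have hD : (tensorOne ρ + oneTensor ρ - midOne ρ) (htmul (htmul v v) u) = 0 := by
    refine apply_eq_zero_of_inner_eq_zero (sub_nonneg.2 h.triangle) ?_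
    rw [sub_apply, add_apply, inner_sub_right, inner_add_right, inner_oneTensor_htmul,
      inner_midOne_htmul, tensorOne_htmul, hvv, zero_htmul, inner_zero_right, zero_add, mul_comm,
      sub_self]
  have hpair : inner ℂ v v * inner ℂ (htmul u v) (ρ (htmul v u)) = 0 := by
    have hw := congrArg (inner ℂ (htmul (htmul v u) v)) hD
    rwa [sub_apply, add_apply, inner_sub_right, inner_add_right, inner_oneTensor_htmul,
      inner_midOne_htmul, tensorOne_htmul, hvv, zero_htmul, inner_zero_right, zero_add,
      ← h.inner_left_eq_inner_right (htmul v v), hvv, inner_zero_left, zero_mul, sub_zero] at hw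
  refine apply_eq_zero_of_inner_eq_zero h.nonneg ?_
  rw [← neg_eq_zero, ← inner_neg_right, ← h.apply_htmul_swap hW hu hv]
  exact (mul_eq_zero.1 hpair).resolve_left (inner_self_ne_zero.2 hv0)

theorem inner_smul_eq_inner_smul (hu : u ∈ W) (hv : v ∈ W) :
    inner ℂ u u • v = inner ℂ u v • u := by
  have hz : htmul u v - htmul v u = 0 := by
    refine h.eq_zero_of_apply_eq_zero _
      ((mem_orthogonal_diagonalSubspace_iff h.atomic.dense_span_atomicVectors).2 fun w _ => ?_) ?_
    · rw [inner_sub_right, inner_htmul, inner_htmul, mul_comm, sub_self]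
    · rw [map_sub, h.apply_htmul_eq_zero hW hu hv, h.apply_htmul_eq_zero hW hv hu, sub_zero]
  refine ext_inner_left ℂ fun g => ?_
  have hg := congrArg (inner ℂ (htmul u g)) hz
  simp only [inner_sub_right, inner_htmul, inner_zero_right] at hg
  rw [inner_smul_right, inner_smul_right, sub_eq_zero.1 hg]

end IsCompactQuantumMetricSpace

end Collapse

section Diagonal

universe u v

section EigenCharacters

variable {A : Type*} [CStarAlgebra A]
  {H : Type*} [NormedAddCommGroup H] [InnerProductSpace ℂ H] [CompleteSpace H]
  {π : A →⋆ₐ[ℂ] (H →L[ℂ] H)} {v w : H}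

theorem exists_starAlgHom_apply_eq_smul (hv : v ≠ 0) (h : ∀ a, ∃ c : ℂ, π a v = c • v) :
    ∃ χ : A →⋆ₐ[ℂ] ℂ, ∀ a, π a v = χ a • v := by
  choose χ hχ using h
  have huniq : ∀ {a c}, π a v = c • v → χ a = c := fun {a c} hc =>
    smul_left_injective ℂ hv ((hχ a).symm.trans hc)
  refine ⟨StarAlgHom.mk (AlgHom.mk (RingHom.mk (MonoidHom.mk (OneHom.mk χ ?_) ?_) ?_ ?_) ?_) ?_, hχ⟩
  · exact huniq (by simp)
  · exact fun a a' => huniq (by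
      rw [map_mul, mul_apply_eq_comp, hχ a', map_smul, hχ a, smul_smul, mul_comm])
  · exact huniq (by simp)
  · exact fun a a' => huniq (by rw [map_add, add_apply, hχ, hχ, add_smul])
  · exact fun c => huniq (by simp [Algebra.algebraMap_eq_smul_one])
  · intro a
    refine mul_right_cancel₀ (inner_self_ne_zero (𝕜 := ℂ).2 hv) ?_
    change χ (star a) * _ = star (χ a) * _
    rw [← inner_smul_right, ← hχ, ← inner_map_star_apply, star_star, hχ, inner_smul_left]
    rfl

theorem rankOne_mem_centralizer {χ : A →⋆ₐ[ℂ] ℂ} (hv : ∀ a, π a v = χ a • v)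
    (hw : ∀ a, π a w = χ a • w) : rankOne ℂ v w ∈ Set.centralizer (Set.range π) := by
  rintro _ ⟨a, rfl⟩
  ext z
  rw [mul_apply_eq_comp, mul_apply_eq_comp, InnerProductSpace.rankOne_apply,
    InnerProductSpace.rankOne_apply, map_smul, hv, ← inner_map_star_apply, hw, map_star,
    inner_smul_left, Complex.star_def, Complex.conj_conj, smul_smul, mul_comm]

end EigenCharacters

/-- The Hilbert basis `b` diagonalizes the representation `π`, with pairwise distinct
eigencharacters `χ i`. Such a basis presents `π(A)` as an algebra of functions on the discrete
space `ι`. -/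
structure IsDiagonalBasis {A : Type*} [CStarAlgebra A] {H : Type*} [NormedAddCommGroup H]
    [InnerProductSpace ℂ H] [CompleteSpace H] {ι : Type*} (π : A →⋆ₐ[ℂ] (H →L[ℂ] H))
    (b : HilbertBasis ι ℂ H) (χ : ι → A →⋆ₐ[ℂ] ℂ) : Prop where
  injective : Function.Injective χ
  apply_basis : ∀ i a, π a (b i) = χ i a • b i

theorem exists_isDiagonalBasis_of_mem_atomicVectors {A H ι : Type*} [CStarAlgebra A]
    [NormedAddCommGroup H] [InnerProductSpace ℂ H] [CompleteSpace H]
    {π : A →⋆ₐ[ℂ] (H →L[ℂ] H)} {b : HilbertBasis ι ℂ H} (hb : ∀ i, b i ∈ atomicVectors π)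
    (hπ : ∀ i a, ∃ c : ℂ, π a (b i) = c • b i) : ∃ χ, IsDiagonalBasis π b χ := by
  choose χ hχ using fun i => exists_starAlgHom_apply_eq_smul (b.orthonormal.ne_zero i) (hπ i)
  refine ⟨χ, fun i j hij => ?_, hχ⟩
  by_contra hne
  obtain ⟨c, hc⟩ := hb i _ (rankOne_mem_centralizer (hij ▸ hχ j) (hχ i))
  have hinner := congrArg (inner ℂ (b j)) hc
  simp only [InnerProductSpace.rankOne_apply, inner_hilbertBasis_self, one_smul, inner_smul_right,
    b.orthonormal.2 (Ne.symm hne), mul_zero, one_ne_zero] at hinner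

theorem IsCompactQuantumMetricSpace.exists_isDiagonalBasis {A : Type v} [CStarAlgebra A]
    {H : Type u} [NormedAddCommGroup H] [InnerProductSpace ℂ H] [CompleteSpace H]
    {π : A →⋆ₐ[ℂ] (H →L[ℂ] H)} {ρ : HilbertTensor H H →L[ℂ] HilbertTensor H H}
    (h : IsCompactQuantumMetricSpace π ρ) :
    ∃ (ι : Type u) (b : HilbertBasis ι ℂ H) (χ : ι → A →⋆ₐ[ℂ] ℂ), IsDiagonalBasis π b χ := by
  obtain ⟨ι, E, _, _, _, σ, V, hd⟩ := h.atomic.exists_isAtomicDecomposition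
  have hunit : ∀ i, ∃ e : E i, ‖e‖ = 1 := fun i =>
    haveI := (hd.irreducible i).1
    exists_norm_eq (E i) zero_le_one
  choose e he using hunit
  have hline : ∀ i y, V i y = inner ℂ (V i (e i)) (V i y) • V i (e i) := fun i y => by
    have hW : ((V i).range : Set H) ⊆ atomicVectors π := by
      rintro _ ⟨x, rfl⟩
      exact hd.mem_atomicVectors i x
    have hey := h.inner_smul_eq_inner_smul hW ⟨e i, rfl⟩ ⟨y, rfl⟩
    rwa [LinearIsometry.coe_toLinearMap, inner_self_eq_one_of_norm_eq_one
      (((V i).norm_map (e i)).trans (he i)), one_smul] at hey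
  have hon : Orthonormal ℂ fun i => V i (e i) :=
    ⟨fun i => by rw [LinearIsometry.norm_map, he], fun i j hij => hd.orthogonal hij _ _⟩
  let b : HilbertBasis ι ℂ H := HilbertBasis.mkOfOrthogonalEqBot hon <| by
    rw [Submodule.eq_bot_iff]
    refine fun z hz => hd.total z fun i x => ?_
    rw [hline i x, inner_smul_left,
      (Submodule.mem_orthogonal _ _).1 hz _ (Submodule.subset_span ⟨i, rfl⟩), mul_zero]
  have hb : ∀ i, b i = V i (e i) := fun i => by simp [b]
  obtain ⟨χ, hχ⟩ := exists_isDiagonalBasis_of_mem_atomicVectors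
    (fun i => hb i ▸ hd.mem_atomicVectors i (e i))
    fun i a => ⟨_, by rw [hb, hd.intertwine]; exact hline i _⟩
  exact ⟨ι, b, χ, hχ⟩

theorem eq_inner_smul_hilbertBasis {ι H : Type*} [NormedAddCommGroup H] [InnerProductSpace ℂ H]
    (b : HilbertBasis ι ℂ H) {i : ι} {z : H} (hz : ∀ k ≠ i, inner ℂ (b k) z = 0) :
    z = inner ℂ (b i) z • b i := by
  refine sub_eq_zero.1 (eq_zero_of_inner_hilbertBasis b fun k => ?_)
  rw [inner_sub_right, inner_smul_right]
  rcases eq_or_ne k i with rfl | hk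
  · rw [inner_hilbertBasis_self, mul_one, sub_self]
  · rw [hz k hk, b.orthonormal.2 hk, mul_zero, sub_zero]

namespace IsDiagonalBasis

variable {A : Type*} [CStarAlgebra A]
  {H : Type*} [NormedAddCommGroup H] [InnerProductSpace ℂ H] [CompleteSpace H]
  {ι : Type*} {π : A →⋆ₐ[ℂ] (H →L[ℂ] H)} {b : HilbertBasis ι ℂ H} {χ : ι → A →⋆ₐ[ℂ] ℂ}
  (h : IsDiagonalBasis π b χ)
include h

theorem mem_atomicVectors (i : ι) : b i ∈ atomicVectors π := by
  intro T hT
  refine ⟨_, eq_inner_smul_hilbertBasis b fun k hk => ?_⟩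
  obtain ⟨a, ha⟩ := DFunLike.ne_iff.1 (h.injective.ne hk)
  have hπT : π a (T (b i)) = χ i a • T (b i) := by
    rw [← map_smul, ← h.apply_basis]
    exact DFunLike.congr_fun (hT _ ⟨a, rfl⟩) (b i)
  have heq := inner_hilbertBasis_apply (h.apply_basis · a) k (T (b i))
  rw [hπT, inner_smul_right] at heq
  by_contra hne
  exact ha (mul_right_cancel₀ hne heq).symm

theorem dense_span_atomicVectors : Dense (Submodule.span ℂ (atomicVectors π) : Set H) :=
  (dense_span_hilbertBasis b).mono
    (Submodule.span_mono (Set.range_subset_iff.2 h.mem_atomicVectors))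

theorem eq_zero_or_exists_eq_smul_of_mem_atomicVectors {v : H} (hv : v ∈ atomicVectors π) :
    v = 0 ∨ ∃ (i : ι) (c : ℂ), v = c • b i := by
  refine or_iff_not_imp_left.2 fun hv0 => ?_
  obtain ⟨i, hi⟩ : ∃ i, inner ℂ (b i) v ≠ 0 := by
    by_contra! hall
    exact hv0 (eq_zero_of_inner_hilbertBasis b hall)
  obtain ⟨c, hc⟩ := hv _ (rankOne_mem_centralizer (h.apply_basis i) (h.apply_basis i))
  rw [InnerProductSpace.rankOne_apply] at hc
  have hc0 : c ≠ 0 := by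
    rintro rfl
    exact smul_ne_zero hi (b.orthonormal.ne_zero i) (hc.trans (zero_smul ℂ v))
  exact ⟨i, c⁻¹ * inner ℂ (b i) v, by rw [mul_smul, hc, inv_smul_smul₀ hc0]⟩

theorem mul_diagonalProjection_eq_zero_iff {T : HilbertTensor H H →L[ℂ] HilbertTensor H H} :
    T * diagonalProjection π = 0 ↔ ∀ i, T (htmul (b i) (b i)) = 0 := by
  rw [QuantumMetric.mul_diagonalProjection_eq_zero_iff h.dense_span_atomicVectors]
  refine ⟨fun hT i => hT _ (h.mem_atomicVectors i), fun hT v hv => ?_⟩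
  obtain rfl | ⟨i, c, rfl⟩ := h.eq_zero_or_exists_eq_smul_of_mem_atomicVectors hv
  · rw [zero_htmul, map_zero]
  · rw [smul_htmul, htmul_smul, map_smul, map_smul, hT, smul_zero, smul_zero]

theorem mem_orthogonal_diagonalSubspace_iff {z : HilbertTensor H H} :
    z ∈ (diagonalSubspace π)ᗮ ↔ ∀ i, inner ℂ (htmul (b i) (b i)) z = 0 := by
  rw [QuantumMetric.mem_orthogonal_diagonalSubspace_iff h.dense_span_atomicVectors]
  refine ⟨fun hz i => hz _ (h.mem_atomicVectors i), fun hz v hv => ?_⟩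
  obtain rfl | ⟨i, c, rfl⟩ := h.eq_zero_or_exists_eq_smul_of_mem_atomicVectors hv
  · rw [zero_htmul, inner_zero_left]
  · rw [smul_htmul, htmul_smul, inner_smul_left, inner_smul_left, hz, mul_zero, mul_zero]

end IsDiagonalBasis

end Diagonal

section Lines

universe u v

theorem isIrreducibleRep_of_finrank_eq_one {A E : Type*} [CStarAlgebra A] [NormedAddCommGroup E]
    [InnerProductSpace ℂ E] [CompleteSpace E] (σ : A →⋆ₐ[ℂ] (E →L[ℂ] E))
    (hE : Module.finrank ℂ E = 1) : IsIrreducibleRep σ :=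
  haveI : IsSimpleModule ℂ E := isSimpleModule_iff_finrank_eq_one.2 hE
  ⟨IsSimpleModule.nontrivial ℂ E, fun V _ _ => eq_bot_or_eq_top V⟩

theorem IsDiagonalBasis.isAtomicRep {A : Type v} [CStarAlgebra A] {H ι : Type u}
    [NormedAddCommGroup H] [InnerProductSpace ℂ H] [CompleteSpace H]
    {π : A →⋆ₐ[ℂ] (H →L[ℂ] H)} {b : HilbertBasis ι ℂ H} {χ : ι → A →⋆ₐ[ℂ] ℂ}
    (h : IsDiagonalBasis π b χ) : IsAtomicRep π := by
  let σ : ∀ i, A →⋆ₐ[ℂ] (↥(ℂ ∙ b i) →L[ℂ] ↥(ℂ ∙ b i)) := fun i =>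
    (StarAlgHom.ofId ℂ (↥(ℂ ∙ b i) →L[ℂ] ↥(ℂ ∙ b i))).comp (χ i)
  have hσ : ∀ i a x, σ i a x = χ i a • x := fun i a x => by
    change algebraMap ℂ (↥(ℂ ∙ b i) →L[ℂ] ↥(ℂ ∙ b i)) (χ i a) x = _
    rw [Algebra.algebraMap_eq_smul_one, smul_apply, one_apply_eq_self]
  let e : ∀ i, ↥(ℂ ∙ b i) := fun i => ⟨b i, Submodule.mem_span_singleton_self _⟩
  have he : ∀ i (x : ↥(ℂ ∙ b i)), ∃ c : ℂ, c • e i = x := fun i x =>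
    (Submodule.mem_span_singleton.1 x.2).imp fun c hc => Subtype.ext hc
  suffices IsAtomicDecomposition π σ fun i => (ℂ ∙ b i).subtypeₗᵢ from this.isAtomicRep
  refine ⟨fun i => isIrreducibleRep_of_finrank_eq_one _
    (finrank_span_singleton (b.orthonormal.ne_zero i)), ?_, ?_,
    fun z hz => eq_zero_of_inner_hilbertBasis b fun i => hz i (e i), fun i a x => ?_⟩
  · rintro i j hij ⟨U, hU⟩
    have hUe : U (e i) ≠ 0 := fun h0 => b.orthonormal.ne_zero i
      (congrArg Subtype.val ((map_eq_zero_iff U U.injective).1 h0))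
    refine hij (h.injective (DFunLike.ext _ _ fun a => smul_left_injective ℂ hUe ?_))
    simpa only [hσ, map_smul] using hU a (e i)
  · intro i j hij x y
    obtain ⟨c, rfl⟩ := he i x
    obtain ⟨d, rfl⟩ := he j y
    rw [map_smul, map_smul, inner_smul_left, inner_smul_right]
    exact mul_eq_zero_of_right _ (mul_eq_zero_of_right _ (b.orthonormal.2 hij))
  · obtain ⟨c, rfl⟩ := he i x
    rw [hσ, map_smul, map_smul, map_smul, map_smul, smul_comm]
    exact congrArg (c • ·) (h.apply_basis i a)

end Lines

section SpatialTensor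

variable {A B : Type*} [CStarAlgebra A] [CStarAlgebra B]
  {H K : Type*} [NormedAddCommGroup H] [InnerProductSpace ℂ H] [CompleteSpace H]
  [NormedAddCommGroup K] [InnerProductSpace ℂ K] [CompleteSpace K]
  {π : A →⋆ₐ[ℂ] (H →L[ℂ] H)} {σ : B →⋆ₐ[ℂ] (K →L[ℂ] K)}

theorem opTensor_mem_spatialTensor (a : A) (b : B) :
    opTensor (π a) (σ b) ∈ spatialTensor π σ :=
  StarSubalgebra.le_topologicalClosure _ (StarAlgebra.subset_adjoin ℂ _ ⟨a, b, rfl⟩)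

theorem spatialTensor_le {S : StarSubalgebra ℂ (HilbertTensor H K →L[ℂ] HilbertTensor H K)}
    (hS : IsClosed (S : Set (HilbertTensor H K →L[ℂ] HilbertTensor H K)))
    (h : ∀ a b, opTensor (π a) (σ b) ∈ S) : spatialTensor π σ ≤ S :=
  StarSubalgebra.topologicalClosure_minimal
    (StarAlgebra.adjoin_le (by rintro _ ⟨a, b, rfl⟩; exact h a b)) hS

theorem map_mem_of_mem_spatialTensor {L : Type*} [NormedAddCommGroup L] [InnerProductSpace ℂ L]
    [CompleteSpace L] (F : (HilbertTensor H K →L[ℂ] HilbertTensor H K) →⋆ₐ[ℂ] (L →L[ℂ] L))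
    {S : StarSubalgebra ℂ (L →L[ℂ] L)} (hS : IsClosed (S : Set (L →L[ℂ] L)))
    (h : ∀ a b, F (opTensor (π a) (σ b)) ∈ S) {T : HilbertTensor H K →L[ℂ] HilbertTensor H K}
    (hT : T ∈ spatialTensor π σ) : F T ∈ S :=
  spatialTensor_le (S := S.comap F) (hS.preimage (map_continuous F)) h hT

namespace IsDiagonalBasis

variable {ι κ : Type*} {b : HilbertBasis ι ℂ H} {c : HilbertBasis κ ℂ K}
  {χ : ι → A →⋆ₐ[ℂ] ℂ} {ψ : κ → B →⋆ₐ[ℂ] ℂ}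
  (hb : IsDiagonalBasis π b χ) (hc : IsDiagonalBasis σ c ψ)
include hb hc

theorem opTensor_apply_tensorBasis (p : ι × κ) (a : A) (a' : B) :
    opTensor (π a) (σ a') (tensorBasis b c p) = (χ p.1 a * ψ p.2 a') • tensorBasis b c p := by
  rw [tensorBasis_apply, opTensor_htmul, hb.apply_basis, hc.apply_basis, smul_htmul, htmul_smul,
    smul_smul]

/- An operator commuting with the projection onto a line preserves the line, and these operators
form a closed star subalgebra. -/
theorem exists_apply_tensorBasis_eq_smul {T : HilbertTensor H K →L[ℂ] HilbertTensor H K}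
    (hT : T ∈ spatialTensor π σ) (p : ι × κ) :
    ∃ t : ℂ, T (tensorBasis b c p) = t • tensorBasis b c p := by
  set w := tensorBasis b c p
  have hle : spatialTensor π σ ≤ StarSubalgebra.centralizer ℂ {rankOne ℂ w w} := by
    refine spatialTensor_le ?_ fun a a' => ?_
    · rw [StarSubalgebra.coe_centralizer]
      exact Set.isClosed_centralizer _
    · have hcomm : Commute (opTensor (π a) (σ a')) (rankOne ℂ w w) :=
        commute_rankOne (hb.opTensor_apply_tensorBasis hc p a a') (by
          rw [star_opTensor, ← map_star, ← map_star, hb.opTensor_apply_tensorBasis hc])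
      have hsa : star (rankOne ℂ w w) = rankOne ℂ w w := by
        rw [ContinuousLinearMap.star_eq_adjoint, InnerProductSpace.adjoint_rankOne]
      rw [StarSubalgebra.mem_centralizer_iff]
      rintro _ rfl
      rw [hsa]
      exact ⟨hcomm.eq.symm, hcomm.eq.symm⟩
  have h := DFunLike.congr_fun ((StarSubalgebra.mem_centralizer_iff ℂ).1 (hle hT) _ rfl).1 w
  rw [mul_apply_eq_comp, mul_apply_eq_comp, InnerProductSpace.rankOne_apply,
    InnerProductSpace.rankOne_apply, inner_hilbertBasis_self, one_smul] at h
  exact ⟨_, h.symm⟩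

theorem tensor : ∃ ω : ι × κ → spatialTensor π σ →⋆ₐ[ℂ] ℂ,
    IsDiagonalBasis (tensorRep π σ) (tensorBasis b c) ω := by
  choose ω hω using fun p => exists_starAlgHom_apply_eq_smul (π := tensorRep π σ)
    ((tensorBasis b c).orthonormal.ne_zero p) fun T =>
      hb.exists_apply_tensorBasis_eq_smul hc T.2 p
  refine ⟨ω, fun p q hpq => ?_, hω⟩
  have hval : ∀ p a a', ω p ⟨_, opTensor_mem_spatialTensor a a'⟩ = χ p.1 a * ψ p.2 a' :=
    fun p a a' => smul_left_injective ℂ ((tensorBasis b c).orthonormal.ne_zero p)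
      ((hω p _).symm.trans (hb.opTensor_apply_tensorBasis hc p a a'))
  have h : ∀ a a', χ p.1 a * ψ p.2 a' = χ q.1 a * ψ q.2 a' := fun a a' => by
    rw [← hval, hpq, hval]
  refine Prod.ext (hb.injective (DFunLike.ext _ _ fun a => ?_))
    (hc.injective (DFunLike.ext _ _ fun a' => ?_))
  · simpa only [map_one, mul_one] using h a 1
  · simpa only [map_one, one_mul] using h 1 a'

theorem exists_real_apply_htmul
    {T : HilbertTensor H K →L[ℂ] HilbertTensor H K} (hT : T ∈ spatialTensor π σ)
    (hsa : IsSelfAdjoint T) :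
    ∃ d : ι → κ → ℝ, ∀ i j, T (htmul (b i) (c j)) = (d i j : ℂ) • htmul (b i) (c j) := by
  obtain ⟨ω, hω⟩ := hb.tensor hc
  let T' : spatialTensor π σ := ⟨T, hT⟩
  have hsa' : IsSelfAdjoint T' := Subtype.ext hsa
  refine ⟨fun i j => (ω (i, j) T').re, fun i j => ?_⟩
  rw [Complex.conj_eq_iff_re.1 (hsa'.map (ω (i, j))), ← tensorBasis_apply b c (i, j)]
  exact hω.apply_basis (i, j) T'

end IsDiagonalBasis

end SpatialTensor

section ClassicalMetric

universe u v

/-- A genuine (real valued) metric on the set `ι`, given by its distance function. -/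
structure IsMetric {ι : Type*} (d : ι → ι → ℝ) : Prop where
  self : ∀ i, d i i = 0
  eq_of_eq_zero : ∀ i j, d i j = 0 → i = j
  symm : ∀ i j, d i j = d j i
  triangle : ∀ i j k, d i k ≤ d i j + d j k

namespace IsMetric

theorem nonneg {ι : Type*} {d : ι → ι → ℝ} (hd : IsMetric d) (i j : ι) : 0 ≤ d i j := by
  have h := hd.triangle i j i
  rw [hd.self, hd.symm j i] at h
  linarith

theorem add {ι κ : Type*} {d : ι → ι → ℝ} {e : κ → κ → ℝ} (hd : IsMetric d) (he : IsMetric e) :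
    IsMetric fun p q : ι × κ => d p.1 q.1 + e p.2 q.2 where
  self p := by rw [hd.self, he.self, add_zero]
  eq_of_eq_zero p q h := by
    obtain ⟨h₁, h₂⟩ := (add_eq_zero_iff_of_nonneg (hd.nonneg _ _) (he.nonneg _ _)).1 h
    exact Prod.ext (hd.eq_of_eq_zero _ _ h₁) (he.eq_of_eq_zero _ _ h₂)
  symm p q := by rw [hd.symm, he.symm]
  triangle p q r := by linarith [hd.triangle p.1 q.1 r.1, he.triangle p.2 q.2 r.2]

end IsMetric

section DiagonalOperator

variable {H : Type*} [NormedAddCommGroup H] [InnerProductSpace ℂ H]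
  {ι : Type*} {b : HilbertBasis ι ℂ H} {T : HilbertTensor H H →L[ℂ] HilbertTensor H H}
  {d : ι → ι → ℝ} (hd : ∀ i j, T (htmul (b i) (b j)) = (d i j : ℂ) • htmul (b i) (b j))
include hd

theorem apply_tensorBasis_eq_smul (p : ι × ι) :
    T (tensorBasis b b p) = (d p.1 p.2 : ℂ) • tensorBasis b b p := by
  rw [tensorBasis_apply, hd]

theorem apply_htmul_eq_zero_iff (i j : ι) : T (htmul (b i) (b j)) = 0 ↔ d i j = 0 := by
  have hne : htmul (b i) (b j) ≠ 0 := (orthonormal_htmul b b).ne_zero (i, j)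
  rw [hd, smul_eq_zero_iff_left hne, Complex.ofReal_eq_zero]

theorem flip_eq_iff : flip T = T ↔ ∀ i j, d i j = d j i := by
  have hflip : ∀ i j, flip T (htmul (b i) (b j)) = (d j i : ℂ) • htmul (b i) (b j) := fun i j => by
    rw [flip_htmul, hd, map_smul, hcomm_htmul]
  refine ⟨fun h i j => ?_, fun h => ext_hilbertBasis (tensorBasis b b) fun p => ?_⟩
  · have hij := DFunLike.congr_fun h (htmul (b i) (b j))
    rw [hflip, hd] at hij
    exact_mod_cast (smul_left_injective ℂ ((orthonormal_htmul b b).ne_zero (i, j)) hij).symm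
  · rw [tensorBasis_apply, hflip, hd, h]

theorem midOne_le_iff [CompleteSpace H] :
    midOne T ≤ tensorOne T + oneTensor T ↔ ∀ i j k, d i k ≤ d i j + d j k := by
  have hdiag : ∀ p : (ι × ι) × ι,
      (tensorOne T + oneTensor T - midOne T) (tensorBasis (tensorBasis b b) b p) =
        ((d p.1.1 p.1.2 + d p.1.2 p.2 - d p.1.1 p.2 : ℝ) : ℂ) •
          tensorBasis (tensorBasis b b) b p := fun p => by
    rw [tensorBasis_apply, tensorBasis_apply, sub_apply, add_apply, tensorOne_htmul,
      oneTensor_htmul, midOne_htmul, hd, hd, hd, smul_htmul, htmul_smul, smul_htmul, map_smul,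
      map_smul, hassoc_symm_htmul, hrightComm_htmul, ← add_smul, ← sub_smul, Complex.ofReal_sub,
      Complex.ofReal_add]
  rw [← sub_nonneg, nonneg_iff_of_apply_hilbertBasis hdiag]
  simp only [Prod.forall, sub_nonneg]

end DiagonalOperator

namespace IsDiagonalBasis

theorem eq_zero_of_apply_eq_zero_iff {A H ι : Type*} [CStarAlgebra A]
    [NormedAddCommGroup H] [InnerProductSpace ℂ H] [CompleteSpace H]
    {π : A →⋆ₐ[ℂ] (H →L[ℂ] H)} {ρ : HilbertTensor H H →L[ℂ] HilbertTensor H H}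
    {b : HilbertBasis ι ℂ H} {χ : ι → A →⋆ₐ[ℂ] ℂ} {d : ι → ι → ℝ} (hb : IsDiagonalBasis π b χ)
    (hd : ∀ i j, ρ (htmul (b i) (b j)) = (d i j : ℂ) • htmul (b i) (b j)) :
    (∀ x ∈ (diagonalSubspace π)ᗮ, ρ x = 0 → x = 0) ↔ ∀ i j, d i j = 0 → i = j := by
  refine ⟨fun h i j hij => ?_, fun h x hx hρ => ?_⟩
  · by_contra hne
    refine (orthonormal_htmul b b).ne_zero (i, j)
      (h _ (hb.mem_orthogonal_diagonalSubspace_iff.2 fun k => ?_)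
        ((apply_htmul_eq_zero_iff hd i j).2 hij))
    exact (orthonormal_htmul b b).2 (i := (k, k)) (j := (i, j))
      fun hk => hne ((congrArg Prod.fst hk).symm.trans (congrArg Prod.snd hk))
  · refine eq_zero_of_inner_hilbertBasis (tensorBasis b b) fun p => ?_
    by_cases hp : d p.1 p.2 = 0
    · rw [tensorBasis_apply, ← h _ _ hp]
      exact hb.mem_orthogonal_diagonalSubspace_iff.1 hx p.1
    · have hpx := inner_hilbertBasis_apply (apply_tensorBasis_eq_smul hd) p x
      rw [hρ, inner_zero_right] at hpx
      exact (mul_eq_zero.1 hpx.symm).resolve_left (Complex.ofReal_ne_zero.2 hp)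

theorem isCompactQuantumMetricSpace_iff {A : Type v} [CStarAlgebra A] {H ι : Type u}
    [NormedAddCommGroup H] [InnerProductSpace ℂ H] [CompleteSpace H]
    {π : A →⋆ₐ[ℂ] (H →L[ℂ] H)} {ρ : HilbertTensor H H →L[ℂ] HilbertTensor H H}
    {b : HilbertBasis ι ℂ H} {χ : ι → A →⋆ₐ[ℂ] ℂ} {d : ι → ι → ℝ} (hb : IsDiagonalBasis π b χ)
    (hd : ∀ i j, ρ (htmul (b i) (b j)) = (d i j : ℂ) • htmul (b i) (b j))
    (hπ : Function.Injective π) (hρ : ρ ∈ spatialTensor π π) :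
    IsCompactQuantumMetricSpace π ρ ↔ IsMetric d := by
  have hdiag : ρ * diagonalProjection π = 0 ↔ ∀ i, d i i = 0 := by
    simp only [hb.mul_diagonalProjection_eq_zero_iff, apply_htmul_eq_zero_iff hd]
  refine ⟨fun h => ?_, fun h => ?_⟩
  · exact ⟨hdiag.1 h.mul_diagonal,
      (hb.eq_zero_of_apply_eq_zero_iff hd).1 h.eq_zero_of_apply_eq_zero,
      (flip_eq_iff hd).1 h.flip_eq, (midOne_le_iff hd).1 h.triangle⟩
  · have hnonneg : 0 ≤ ρ :=
      (nonneg_iff_of_apply_hilbertBasis (apply_tensorBasis_eq_smul hd)).2 fun p => h.nonneg p.1 p.2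
    have hmul := hdiag.2 h.self
    refine ⟨hπ, hb.isAtomicRep, hρ, hnonneg, hmul, ?_,
      (hb.eq_zero_of_apply_eq_zero_iff hd).2 h.eq_of_eq_zero, (flip_eq_iff hd).2 h.symm,
      (midOne_le_iff hd).2 h.triangle⟩
    have hstar := congrArg star hmul
    rwa [star_mul, star_zero, (IsSelfAdjoint.of_nonneg hnonneg).star_eq, diagonalProjection,
      (isSelfAdjoint_starProjection _).star_eq] at hstar

end IsDiagonalBasis

theorem IsCompactQuantumMetricSpace.exists_isMetric {A : Type v} [CStarAlgebra A]
    {H : Type u} [NormedAddCommGroup H] [InnerProductSpace ℂ H] [CompleteSpace H]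
    {π : A →⋆ₐ[ℂ] (H →L[ℂ] H)} {ρ : HilbertTensor H H →L[ℂ] HilbertTensor H H}
    (h : IsCompactQuantumMetricSpace π ρ) :
    ∃ (ι : Type u) (b : HilbertBasis ι ℂ H) (χ : ι → A →⋆ₐ[ℂ] ℂ) (d : ι → ι → ℝ),
      IsDiagonalBasis π b χ ∧ IsMetric d ∧
        ∀ i j, ρ (htmul (b i) (b j)) = (d i j : ℂ) • htmul (b i) (b j) := by
  obtain ⟨ι, b, χ, hb⟩ := h.exists_isDiagonalBasis
  obtain ⟨d, hd⟩ := hb.exists_real_apply_htmul hb h.mem (IsSelfAdjoint.of_nonneg h.nonneg)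
  exact ⟨ι, b, χ, d, hb, (hb.isCompactQuantumMetricSpace_iff hd h.faithful h.mem).1 h, hd⟩

end ClassicalMetric

section SumMetric

section Interchange

variable {H K L M : Type*}
  [NormedAddCommGroup H] [InnerProductSpace ℂ H] [NormedAddCommGroup K] [InnerProductSpace ℂ K]
  [NormedAddCommGroup L] [InnerProductSpace ℂ L] [NormedAddCommGroup M] [InnerProductSpace ℂ M]

theorem conj_hinterchange_apply_htmul
    (T : HilbertTensor (HilbertTensor H K) (HilbertTensor L M) →L[ℂ]
      HilbertTensor (HilbertTensor H K) (HilbertTensor L M)) (x : H) (y : K) (z : L) (w : M) :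
    (hinterchange H K L M).conjStarAlgEquiv T (htmul (htmul x z) (htmul y w)) =
      hinterchange H K L M (T (htmul (htmul x y) (htmul z w))) := by
  have hsymm : (hinterchange H K L M).symm (htmul (htmul x z) (htmul y w)) =
      htmul (htmul x y) (htmul z w) := by
    rw [LinearIsometryEquiv.symm_apply_eq, hinterchange_htmul]
  simp [LinearIsometryEquiv.conjStarAlgEquiv_apply, hsymm]

theorem conj_hinterchange_opTensor (S : H →L[ℂ] H) (T : K →L[ℂ] K) (S' : L →L[ℂ] L)
    (T' : M →L[ℂ] M) :
    (hinterchange H K L M).conjStarAlgEquiv (opTensor (opTensor S T) (opTensor S' T')) =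
      opTensor (opTensor S S') (opTensor T T') :=
  ext_htmul_htmul fun x z y w => by
    simp only [conj_hinterchange_apply_htmul, opTensor_htmul, hinterchange_htmul]

end Interchange

variable {A₁ A₂ H₁ H₂ : Type*} [CStarAlgebra A₁] [CStarAlgebra A₂]
  [NormedAddCommGroup H₁] [InnerProductSpace ℂ H₁] [CompleteSpace H₁]
  [NormedAddCommGroup H₂] [InnerProductSpace ℂ H₂] [CompleteSpace H₂]
  {π₁ : A₁ →⋆ₐ[ℂ] (H₁ →L[ℂ] H₁)} {π₂ : A₂ →⋆ₐ[ℂ] (H₂ →L[ℂ] H₂)}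
  {ρ₁ : HilbertTensor H₁ H₁ →L[ℂ] HilbertTensor H₁ H₁}
  {ρ₂ : HilbertTensor H₂ H₂ →L[ℂ] HilbertTensor H₂ H₂}

theorem conj_hinterchange_opTensor_mem_spatialTensor (a a' : A₁) (b b' : A₂) :
    (hinterchange H₁ H₁ H₂ H₂).conjStarAlgEquiv
        (opTensor (opTensor (π₁ a) (π₁ a')) (opTensor (π₂ b) (π₂ b'))) ∈
      spatialTensor (tensorRep π₁ π₂) (tensorRep π₁ π₂) := by
  rw [conj_hinterchange_opTensor]
  exact opTensor_mem_spatialTensor (π := tensorRep π₁ π₂) (σ := tensorRep π₁ π₂)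
    ⟨_, opTensor_mem_spatialTensor a b⟩ ⟨_, opTensor_mem_spatialTensor a' b'⟩

theorem sumMetric_mem_spatialTensor (h₁ : ρ₁ ∈ spatialTensor π₁ π₁)
    (h₂ : ρ₂ ∈ spatialTensor π₂ π₂) :
    sumMetric ρ₁ ρ₂ ∈ spatialTensor (tensorRep π₁ π₂) (tensorRep π₁ π₂) := by
  let Φ := (hinterchange H₁ H₁ H₂ H₂).conjStarAlgEquiv.toStarAlgHom
  have hleft : Φ.comp (amplifyLeft _ _) ρ₁ ∈
      spatialTensor (tensorRep π₁ π₂) (tensorRep π₁ π₂) := by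
    refine map_mem_of_mem_spatialTensor _ (spatialTensor_isClosed _ _) (fun a a' => ?_) h₁
    have hmem := conj_hinterchange_opTensor_mem_spatialTensor (π₁ := π₁) (π₂ := π₂) a a' 1 1
    rwa [map_one, opTensor_one] at hmem
  have hright : Φ.comp (amplifyRight _ _) ρ₂ ∈
      spatialTensor (tensorRep π₁ π₂) (tensorRep π₁ π₂) := by
    refine map_mem_of_mem_spatialTensor _ (spatialTensor_isClosed _ _) (fun b b' => ?_) h₂
    have hmem := conj_hinterchange_opTensor_mem_spatialTensor (π₁ := π₁) (π₂ := π₂) 1 1 b b'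
    rwa [map_one, opTensor_one] at hmem
  have hsum : sumMetric ρ₁ ρ₂ = Φ.comp (amplifyLeft _ _) ρ₁ + Φ.comp (amplifyRight _ _) ρ₂ :=
    map_add Φ _ _
  rw [hsum]
  exact add_mem hleft hright

theorem sumMetric_htmul {x z : H₁} {y w : H₂} {d e : ℂ}
    (hd : ρ₁ (htmul x z) = d • htmul x z) (he : ρ₂ (htmul y w) = e • htmul y w) :
    sumMetric ρ₁ ρ₂ (htmul (htmul x y) (htmul z w)) =
      (d + e) • htmul (htmul x y) (htmul z w) := by
  rw [sumMetric, conj_hinterchange_apply_htmul, add_apply, opTensor_htmul, opTensor_htmul, hd, he,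
    ContinuousLinearMap.id_apply, ContinuousLinearMap.id_apply, smul_htmul, htmul_smul, ← add_smul,
    map_smul, hinterchange_htmul]

theorem sumMetric_tensorBasis {ι κ : Type*} {b : HilbertBasis ι ℂ H₁} {c : HilbertBasis κ ℂ H₂}
    {d : ι → ι → ℝ} {e : κ → κ → ℝ}
    (hd : ∀ i j, ρ₁ (htmul (b i) (b j)) = (d i j : ℂ) • htmul (b i) (b j))
    (he : ∀ i j, ρ₂ (htmul (c i) (c j)) = (e i j : ℂ) • htmul (c i) (c j)) (p q : ι × κ) :
    sumMetric ρ₁ ρ₂ (htmul (tensorBasis b c p) (tensorBasis b c q)) =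
      ((d p.1 q.1 + e p.2 q.2 : ℝ) : ℂ) • htmul (tensorBasis b c p) (tensorBasis b c q) := by
  rw [tensorBasis_apply, tensorBasis_apply, sumMetric_htmul (hd _ _) (he _ _), Complex.ofReal_add]

end SumMetric

end QuantumMetric

end

theorem theorem4 {A₁ A₂ H₁ H₂ : Type*} [CStarAlgebra A₁] [CStarAlgebra A₂]
    [NormedAddCommGroup H₁] [InnerProductSpace ℂ H₁] [CompleteSpace H₁]
    [NormedAddCommGroup H₂] [InnerProductSpace ℂ H₂] [CompleteSpace H₂]
    (π₁ : A₁ →⋆ₐ[ℂ] (H₁ →L[ℂ] H₁)) (π₂ : A₂ →⋆ₐ[ℂ] (H₂ →L[ℂ] H₂))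
    (ρ₁ : QuantumMetric.HilbertTensor H₁ H₁ →L[ℂ] QuantumMetric.HilbertTensor H₁ H₁)
    (ρ₂ : QuantumMetric.HilbertTensor H₂ H₂ →L[ℂ] QuantumMetric.HilbertTensor H₂ H₂)
    (h₁ : QuantumMetric.IsCompactQuantumMetricSpace π₁ ρ₁)
    (h₂ : QuantumMetric.IsCompactQuantumMetricSpace π₂ ρ₂) :
    QuantumMetric.IsCompactQuantumMetricSpace (QuantumMetric.tensorRep π₁ π₂)
      (QuantumMetric.sumMetric ρ₁ ρ₂) := by
  obtain ⟨ι, b, χ, d, hb, hd, hρ₁⟩ := h₁.exists_isMetric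
  obtain ⟨κ, c, ψ, e, hc, he, hρ₂⟩ := h₂.exists_isMetric
  obtain ⟨ω, hω⟩ := hb.tensor hc
  have hmem := QuantumMetric.sumMetric_mem_spatialTensor h₁.mem h₂.mem
  have hdiag := QuantumMetric.sumMetric_tensorBasis hρ₁ hρ₂
  exact (hω.isCompactQuantumMetricSpace_iff hdiag Subtype.val_injective hmem).2 (hd.add he)
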